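/- Let $V$ be a finite-dimensional $\mathbb{Q}_2$-vector space and let $W\subseteq GL(V)$ be a finite subgroup generated by reflections, where $\sigma\in GL(V)$ is a \emph{reflection} if $1-\sigma$ has rank one. Let $\Sigma$ be the set of reflections in $W$, on which $W$ acts by conjugation, with conjugacy classes $\Sigma_i$. For each $i$ choose $\tau_i\in\Sigma_i$ and $0\neq a_i\in V$ with $\tau_i(a_i)=-a_i$, and let $C_i$ be the centralizer of $\tau_i$ in $W$ and $C_i^\perp$ the stabilizer of $a_i$ in $W$, so that $C_i=\langle\tau_i\rangle\times C_i^\perp$. The \emph{reflection extension} $$1\to\mathbb{Z}[\Sigma]\to\rho(W)\xrightarrow{\ \pi\ }W\to 1$$ is the extension (well defined up to equivalence) whose class in $H^2(W;\mathbb{Z}[\Sigma])=\bigoplus_i H^2(W;\mathbb{Z}[\Sigma_i])$ has as its $i$-th component the class corresponding, under Shapiro's isomorphism $H^2(W;\mathbb{Z}[\Sigma_i])\cong H^2(C_i;\mathbb{Z})$, to the extension $1\to\mathbb{Z}\to\mathbb{Z}\times C_i^\perp\to C_i\to1$ with maps $m\mapsto(2m,1)$ and $(n,c)\mapsto\tau_i^n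 c$. For $\sigma\in\Sigma$ put $C_\sigma=(1-\sigma)\mathbb{Z}[\Sigma]$, $Q_\sigma=\{x\in\rho(W)\mid x^2=\sigma\in\mathbb{Z}[\Sigma]\}$ and $\rho(W)_\sigma=\langle Q_\sigma\rangle\subseteq\rho(W)$. Then the following hold. 1. For $x\in\rho(W)$ with $w=\pi(x)$ and $\sigma\in\Sigma$ we have $xC_\sigma x^{-1}=C_{w\sigma w^{-1}}$ and $xQ_\sigma x^{-1}=Q_{w\sigma w^{-1}}$. 2. $\rho(W)$ contains no elements of order two. 3. $\pi(Q_\sigma)=\{\sigma\}$ for every $\sigma\in\Sigma$. 4. For every $\sigma\in\Sigma$, $C_\sigma$ is a subgroup of $\mathbb{Z}[\Sigma]$, and $C_\sigma=\ker(1+\sigma:\mathbb{Z}[\Sigma]\to\mathbb{Z}[\Sigma])$. 5. For every $\sigma\in\Sigma$, $Q_\sigma$ is a coset of $C_\sigma$ in $\rho(W)$; more precisely, $Q_\sigma$ is non-empty and $Q_\sigma=xC_\sigma=C_\sigma x$ for every $x\in Q_\sigma$. 6. For every $\sigma\in\Sigma$ there is a short exact sequence $1\to C_\sigma\oplus\mathbb{Z}\sigma\to\rho(W)_\sigma\xrightarrow{\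 \pi\ }\langle\sigma\rangle\to1$, whose first map is induced by the inclusion $\mathbb{Z}[\Sigma]\subseteq\rho(W)$ and whose second map is the restriction of $\pi$. -/

import Mathlib

/-- If `ζ ∈ ℚ₂` has finite order, then `ζ = ±1`. -/
theorem padicTwo_eq_one_or_neg_one {ζ : ℚ_[2]} {n : ℕ} (hn : n ≠ 0) (h : ζ ^ n = 1) :
    ζ = 1 ∨ ζ = -1 := by
  have hnorm : ∀ {x : ℚ_[2]} {k : ℕ}, k ≠ 0 → x ^ k = 1 → ‖x‖ = 1 := by
    intro x k hk hx
    have h1 : ‖x‖ ^ k = 1 := by rw [← norm_pow, hx, norm_one]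
    exact (pow_eq_one_iff_of_nonneg (norm_nonneg _) hk).1 h1
  have hodd : ∀ {x : ℚ_[2]} {k : ℕ}, Odd k → x ^ k = 1 → x = 1 := by
    intro x k hk hx
    have hk0 : k ≠ 0 := by rintro rfl; simp at hk
    obtain ⟨u, rfl⟩ : ∃ u : ℤ_[2], (u : ℚ_[2]) = x := ⟨⟨x, (hnorm hk0 hx).le⟩, rfl⟩
    have hu : u ^ k = 1 := PadicInt.ext (by simpa using hx)
    have hred : (PadicInt.toZMod u : ZMod 2) = 1 := by
      have h2 : (PadicInt.toZMod u : ZMod 2) ^ k = 1 := by rw [← map_pow, hu, map_one]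
      have : ∀ y : ZMod 2, y = 0 ∨ y = 1 := by decide
      rcases this (PadicInt.toZMod u) with h0 | h1
      · rw [h0, zero_pow hk0] at h2
        exact absurd h2 (by decide)
      · exact h1
    have hg : (∑ i ∈ Finset.range k, u ^ i) * (u - 1) = 0 := by
      rw [geom_sum_mul, hu, sub_self]
    rcases mul_eq_zero.1 hg with h0 | h0
    · exfalso
      have h3 := congrArg (PadicInt.toZMod (p := 2)) h0
      rw [map_sum, map_zero] at h3
      simp only [map_pow, hred, one_pow, Finset.sum_const, Finset.card_range, nsmul_eq_mul,
        mul_one] at h3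
      rw [ZMod.natCast_eq_zero_iff] at h3
      exact (Nat.not_even_iff_odd.2 hk) (even_iff_two_dvd.2 h3)
    · have : u = 1 := sub_eq_zero.1 h0
      rw [this]; simp
  have hsq : ∀ x : ℚ_[2], x ^ 2 ≠ -1 := by
    intro x hx
    have hx4 : x ^ 4 = 1 := by
      calc x ^ 4 = (x ^ 2) ^ 2 := by ring
        _ = 1 := by rw [hx]; ring
    obtain ⟨u, rfl⟩ : ∃ u : ℤ_[2], (u : ℚ_[2]) = x :=
      ⟨⟨x, (hnorm (by norm_num) hx4).le⟩, rfl⟩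
    have hu : u ^ 2 = -1 := PadicInt.ext (by simpa using hx)
    have h2 := congrArg (PadicInt.toZModPow (p := 2) 2) hu
    rw [map_pow, map_neg, map_one] at h2
    have : ∀ y : ZMod (2 ^ 2), y ^ 2 ≠ -1 := by decide
    exact this _ h2
  have htwo : ∀ (k : ℕ) (x : ℚ_[2]), x ^ (2 ^ k) = 1 → x = 1 ∨ x = -1 := by
    intro k
    induction k with
    | zero => intro x hx; left; simpa using hx
    | succ k ih =>
      intro x hx
      rcases ih (x ^ 2) (by rw [← pow_mul, ← pow_succ']; exact hx) with h1 | h1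
      · exact sq_eq_one_iff.1 h1
      · exact absurd h1 (hsq x)
  obtain ⟨k, m, hm, rfl⟩ := Nat.exists_eq_two_pow_mul_odd hn
  rw [pow_mul] at h
  exact htwo k ζ (hodd hm h)

section ReflectionGroups

variable {V : Type*} [AddCommGroup V] [Module ℚ_[2] V]

/-- A linear automorphism `σ` of a `ℚ₂`-vector space is a reflection if `1 - σ` has rank one. -/
def IsLinearReflection (σ : V ≃ₗ[ℚ_[2]] V) : Prop :=
  Module.finrank ℚ_[2] (LinearMap.range ((LinearMap.id : V →ₗ[ℚ_[2]] V) - σ.toLinearMap)) = 1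

/-- The set `Σ` of reflections in a subgroup `W` of `GL(V)`. -/
abbrev Reflections (W : Subgroup (V ≃ₗ[ℚ_[2]] V)) : Type _ :=
  {σ : W // IsLinearReflection (σ : V ≃ₗ[ℚ_[2]] V)}

/-- `W` is generated by the reflections that it contains. -/
def IsReflectionGroup (W : Subgroup (V ≃ₗ[ℚ_[2]] V)) : Prop :=
  Subgroup.closure {σ | σ ∈ W ∧ IsLinearReflection σ} = W

theorem IsLinearReflection.exists_form {σ : V ≃ₗ[ℚ_[2]] V} (hσ : IsLinearReflection σ) :
    ∃ (b : V) (f : V → ℚ_[2]), b ≠ 0 ∧ (∀ v, σ v = v - f v • b) ∧ ∃ v, f v ≠ 0 := by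
  obtain ⟨⟨b, hb⟩, hb0, hbs⟩ := finrank_eq_one_iff'.1 hσ
  have hb0' : b ≠ 0 := fun h => hb0 (Subtype.ext h)
  have h : ∀ v, ∃ c : ℚ_[2], c • b = v - σ v := by
    intro v
    obtain ⟨c, hc⟩ := hbs ⟨v - σ v, ⟨v, by simp⟩⟩
    exact ⟨c, congrArg Subtype.val hc⟩
  choose f hf using h
  refine ⟨b, f, hb0', fun v => by rw [hf]; abel, ?_⟩
  by_contra! hcon
  obtain ⟨v, hv⟩ := hb
  apply hb0'
  rw [← hv]
  simp only [LinearMap.sub_apply, LinearMap.id_apply, LinearEquiv.coe_coe]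
  rw [← hf v, hcon v, zero_smul]

theorem isLinearReflection_of_form {σ : V ≃ₗ[ℚ_[2]] V} {b : V} {f : V → ℚ_[2]} (hb : b ≠ 0)
    (h : ∀ v, σ v = v - f v • b) (hf : ∃ v, f v ≠ 0) : IsLinearReflection σ := by
  obtain ⟨v₀, hv₀⟩ := hf
  refine finrank_eq_one_iff'.2 ⟨⟨v₀ - σ v₀, ⟨v₀, by simp⟩⟩, ?_, ?_⟩
  · intro h0
    have h1 : v₀ - σ v₀ = 0 := congrArg Subtype.val h0
    rw [h v₀, sub_sub_cancel] at h1
    exact (smul_ne_zero hv₀ hb) h1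
  · rintro ⟨_, ⟨v, rfl⟩⟩
    refine ⟨f v / f v₀, Subtype.ext ?_⟩
    change (f v / f v₀) • (v₀ - σ v₀) = v - σ v
    rw [h v, h v₀, sub_sub_cancel, sub_sub_cancel, smul_smul, div_mul_cancel₀ _ hv₀]

theorem IsLinearReflection.conj {σ : V ≃ₗ[ℚ_[2]] V} (hσ : IsLinearReflection σ)
    (w : V ≃ₗ[ℚ_[2]] V) : IsLinearReflection (w * σ * w⁻¹) := by
  obtain ⟨b, f, hb, h, v, hv⟩ := hσ.exists_form
  refine isLinearReflection_of_form (b := w b) (f := fun v => f (w⁻¹ v)) (by simpa using hb) ?_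
    ⟨w v, ?_⟩
  · intro v
    change w (σ (w⁻¹ v)) = _
    rw [h, map_sub, map_smul]
    congr 1
    exact w.apply_symm_apply v
  · change f (w.symm (w v)) ≠ 0
    simpa using hv

/-- `W` acts on its set of reflections by conjugation. -/
noncomputable instance Reflections.instMulAction (W : Subgroup (V ≃ₗ[ℚ_[2]] V)) :
    MulAction W (Reflections W) where
  smul w σ := ⟨w * σ.1 * w⁻¹, σ.2.conj w⟩
  one_smul σ := Subtype.ext (by change 1 * σ.1 * 1⁻¹ = σ.1; simp)
  mul_smul w w' σ := Subtype.ext (by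
    change (w * w') * σ.1 * (w * w')⁻¹ = w * (w' * σ.1 * w'⁻¹) * w⁻¹
    group)

theorem Reflections.smul_val {W : Subgroup (V ≃ₗ[ℚ_[2]] V)} (w : W) (σ : Reflections W) :
    (w • σ).1 = w * σ.1 * w⁻¹ := rfl

/-- The permutation module `ℤ[Σ]`. -/
abbrev ReflModule (W : Subgroup (V ≃ₗ[ℚ_[2]] V)) : Type _ := Reflections W →₀ ℤ

/-- The `ℤ`-linear action of `w ∈ W` on `ℤ[Σ]`, sending the basis element `σ` to `w σ w⁻¹`. -/
noncomputable def reflAct {W : Subgroup (V ≃ₗ[ℚ_[2]] V)} (w : W) : ReflModule W →+ ReflModule W :=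
  Finsupp.mapDomain.addMonoidHom (fun σ => w • σ)

/-! ### Eigenvectors of reflections -/

theorem eq_smul_of_map_eq_neg {σ : V ≃ₗ[ℚ_[2]] V} (hσ : IsLinearReflection σ) {a v : V}
    (ha : a ≠ 0) (hσa : σ a = -a) (hv : σ v = -v) : ∃ c : ℚ_[2], v = c • a := by
  obtain ⟨b, f, -, h, -⟩ := hσ.exists_form
  have h2 : (2 : ℚ_[2]) ≠ 0 := two_ne_zero
  have key : ∀ u, σ u = -u → u = (f u / 2) • b := by
    intro u hu
    have h1 := h u
    rw [hu] at h1
    have h3 : (2 : ℚ_[2]) • u = f u • b := by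
      rw [two_smul]
      have : f u • b = u - -u := by rw [h1]; abel
      rw [this]; abel
    rw [div_eq_inv_mul, mul_smul, ← h3, smul_smul, inv_mul_cancel₀ h2, one_smul]
  have hfa : f a / 2 ≠ 0 := by
    intro h0
    apply ha
    rw [key a hσa, h0, zero_smul]
  refine ⟨(f v / 2) / (f a / 2), ?_⟩
  calc v = (f v / 2) • b := key v hv
    _ = ((f v / 2) / (f a / 2)) • ((f a / 2) • b) := by
      rw [smul_smul, div_mul_cancel₀ _ hfa]
    _ = ((f v / 2) / (f a / 2)) • a := by rw [← key a hσa]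

/-- Unipotent elements of finite order of the form `v ↦ v - g(v) a`, with `a` fixed, are trivial. -/
theorem transvection_finite_order {u : V ≃ₗ[ℚ_[2]] V} {a : V} {g : V → ℚ_[2]}
    (h : ∀ v, u v = v - g v • a) (hua : u a = a) {n : ℕ} (hn : n ≠ 0) (hu : u ^ n = 1) (v : V) :
    u v = v := by
  have key : ∀ k : ℕ, (u ^ k) v = v - ((k : ℚ_[2]) * g v) • a := by
    intro k
    induction k with
    | zero => simp
    | succ k ih =>
      rw [pow_succ', LinearEquiv.mul_apply, ih, map_sub, map_smul, hua, h v]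
      push_cast
      rw [add_mul, add_smul, one_mul]
      abel
  have h1 := key n
  rw [hu, LinearEquiv.coe_one, id] at h1
  have h2 : ((n : ℚ_[2]) * g v) • a = 0 := by
    have : ((n : ℚ_[2]) * g v) • a = v - (v - ((n : ℚ_[2]) * g v) • a) := by abel
    rw [this, ← h1, sub_self]
  rw [mul_smul, smul_eq_zero] at h2
  rcases h2 with h2 | h2
  · exact absurd (Nat.cast_eq_zero.1 h2) hn
  · rw [h v, h2, sub_zero]

theorem exists_pow_eq_one_val {W : Subgroup (V ≃ₗ[ℚ_[2]] V)} [Finite W] (w : W) :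
    ∃ n : ℕ, n ≠ 0 ∧ (w : V ≃ₗ[ℚ_[2]] V) ^ n = 1 := by
  obtain ⟨n, hn, h⟩ := isOfFinOrder_iff_pow_eq_one.1 (isOfFinOrder_of_finite w)
  exact ⟨n, hn.ne', by rw [← Subgroup.coe_pow, h]; rfl⟩

theorem eigenvalue_eq {w : V ≃ₗ[ℚ_[2]] V} {n : ℕ} (hn : n ≠ 0) (h : w ^ n = 1) {a : V}
    (ha : a ≠ 0) {c : ℚ_[2]} (hc : w a = c • a) : c = 1 ∨ c = -1 := by
  have key : ∀ k : ℕ, (w ^ k) a = c ^ k • a := by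
    intro k
    induction k with
    | zero => simp
    | succ k ih => rw [pow_succ', LinearEquiv.mul_apply, ih, map_smul, hc, smul_smul, pow_succ]
  have h1 := key n
  rw [h, LinearEquiv.coe_one, id] at h1
  refine padicTwo_eq_one_or_neg_one hn ?_
  have h2 : (c ^ n - 1) • a = 0 := by rw [sub_smul, ← h1, one_smul, sub_self]
  rcases smul_eq_zero.1 h2 with h3 | h3
  · exact sub_eq_zero.1 h3
  · exact absurd h3 ha

/-- A reflection in a finite group negates some nonzero vector. -/
theorem Reflections.exists_neg {W : Subgroup (V ≃ₗ[ℚ_[2]] V)} [Finite W] (τ : Reflections W) :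
    ∃ a : V, a ≠ 0 ∧ τ.1.1 a = -a := by
  obtain ⟨b, f, hb, h, v, hv⟩ := τ.2.exists_form
  obtain ⟨n, hn, hn1⟩ := exists_pow_eq_one_val τ.1
  have hc : τ.1.1 b = (1 - f b) • b := by rw [h b, sub_smul, one_smul]
  refine ⟨b, hb, ?_⟩
  rcases eigenvalue_eq hn hn1 hb hc with h1 | h1
  · rw [h1, one_smul] at hc
    have h2 := transvection_finite_order h hc hn hn1 v
    rw [h v] at h2
    exfalso
    refine smul_ne_zero hv hb ?_
    have : f v • b = v - (v - f v • b) := by abel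
    rw [this, h2, sub_self]
  · rw [hc, h1, neg_one_smul]

/-- Elements of `W` commuting with `τ` map `a` to `± a`. -/
theorem Reflections.map_of_commute {W : Subgroup (V ≃ₗ[ℚ_[2]] V)} [Finite W] {τ : Reflections W}
    {a : V} (ha : a ≠ 0) (hτa : τ.1.1 a = -a) {w : W} (hw : w * τ.1 = τ.1 * w) :
    w.1 a = a ∨ w.1 a = -a := by
  have h1 : τ.1.1 (w.1 a) = -(w.1 a) := by
    have h2 : (τ.1 * w).1 a = (w * τ.1).1 a := by rw [hw]
    have h3 : τ.1.1 (w.1 a) = w.1 (τ.1.1 a) := h2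
    rw [h3, hτa, map_neg]
  obtain ⟨c, hc⟩ := eq_smul_of_map_eq_neg τ.2 ha hτa h1
  obtain ⟨n, hn, hn1⟩ := exists_pow_eq_one_val w
  rcases eigenvalue_eq hn hn1 ha hc with h | h
  · left; rw [hc, h, one_smul]
  · right; rw [hc, h, neg_one_smul]

theorem Reflections.form {W : Subgroup (V ≃ₗ[ℚ_[2]] V)} (τ : Reflections W)
    {a : V} (ha : a ≠ 0) (hτa : τ.1.1 a = -a) : ∃ f : V → ℚ_[2], ∀ v, τ.1.1 v = v - f v • a := by
  obtain ⟨b, f, hb, h, -⟩ := τ.2.exists_form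
  have h2 : (2 : ℚ_[2]) • a = f a • b := by
    have h1 := h a
    rw [hτa] at h1
    have : f a • b = a - -a := by rw [h1]; abel
    rw [this, two_smul]; abel
  have hfa : f a ≠ 0 := by
    intro h0
    rw [h0, zero_smul] at h2
    exact smul_ne_zero two_ne_zero ha h2
  refine ⟨fun v => f v * ((f a)⁻¹ * 2), fun v => ?_⟩
  rw [h v, mul_smul, mul_smul, h2, smul_smul (f a)⁻¹, inv_mul_cancel₀ hfa, one_smul]

/-- Elements of `W` fixing `a` commute with `τ`. -/
theorem Reflections.commute_of_map {W : Subgroup (V ≃ₗ[ℚ_[2]] V)} [Finite W] {τ : Reflections W}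
    {a : V} (ha : a ≠ 0) (hτa : τ.1.1 a = -a) {w : W} (hw : w.1 a = a) :
    w * τ.1 = τ.1 * w := by
  obtain ⟨f, hf⟩ := τ.form ha hτa
  have hwi : w.1.symm a = a := by rw [LinearEquiv.symm_apply_eq, hw]
  have hu : ∀ v, (w * τ.1 * w⁻¹ * τ.1).1 v = v - (f v + f (w.1.symm (τ.1.1 v))) • a := by
    intro v
    change w.1 (τ.1.1 (w.1.symm (τ.1.1 v))) = _
    rw [hf (w.1.symm (τ.1.1 v)), map_sub, map_smul, hw, LinearEquiv.apply_symm_apply]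
    rw [add_smul, ← sub_sub, ← hf v]
  have hua : (w * τ.1 * w⁻¹ * τ.1).1 a = a := by
    change w.1 (τ.1.1 (w.1.symm (τ.1.1 a))) = _
    rw [hτa, map_neg, hwi, map_neg, hτa, neg_neg, hw]
  obtain ⟨n, hn, hn1⟩ := exists_pow_eq_one_val (w * τ.1 * w⁻¹ * τ.1)
  have h1 : w * τ.1 * w⁻¹ * τ.1 = 1 :=
    Subtype.ext (LinearEquiv.ext (transvection_finite_order hu hua hn hn1))
  have hv : ∀ v, (τ.1 * τ.1).1 v = v - (f v + f (τ.1.1 v)) • a := by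
    intro v
    change τ.1.1 (τ.1.1 v) = _
    rw [hf (τ.1.1 v)]
    rw [add_smul, ← sub_sub, ← hf v]
  have hva : (τ.1 * τ.1).1 a = a := by
    change τ.1.1 (τ.1.1 a) = _
    rw [hτa, map_neg, hτa, neg_neg]
  obtain ⟨m, hm, hm1⟩ := exists_pow_eq_one_val (τ.1 * τ.1)
  have h2 : τ.1 * τ.1 = 1 :=
    Subtype.ext (LinearEquiv.ext (transvection_finite_order hv hva hm hm1))
  have h3 : τ.1⁻¹ = τ.1 := inv_eq_of_mul_eq_one_right h2
  rw [← h3] at h1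
  have h4 := mul_inv_eq_one.1 h1
  rw [h3] at h4
  calc w * τ.1 = (w * τ.1 * w⁻¹) * w := by group
    _ = τ.1 * w := by rw [h4]

/-! ### The extension of the centralizer of a reflection -/

/-- The homomorphism `ℤ × C^⊥ → C`, `(n, c) ↦ τⁿ c`, where `C` is the centralizer of `τ` in `W` and
`C^⊥` is the stabilizer in `W` of a vector `a ≠ 0` with `τ a = -a`. Under the direct product
decomposition `C = ⟨τ⟩ × C^⊥` it is the product of the projection `ℤ → ℤ/2` and the identity. -/
noncomputable def centralizerHom {W : Subgroup (V ≃ₗ[ℚ_[2]] V)} [Finite W] (τ : Reflections W)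
    {a : V} (ha : a ≠ 0) (hτa : τ.1.1 a = -a) :
    Multiplicative ℤ × MulAction.stabilizer W a →* Subgroup.centralizer {τ.1} :=
  MonoidHom.mk' (fun x => ⟨τ.1 ^ x.1.toAdd * x.2.1, by
    have h : Commute τ.1 x.2.1 := (τ.commute_of_map ha hτa x.2.2).symm
    exact Subgroup.mem_centralizer_singleton_iff.2
      (((Commute.refl τ.1).zpow_right x.1.toAdd).mul_right h).eq.symm⟩) (by
    rintro ⟨m, c⟩ ⟨n, d⟩
    have h : Commute τ.1 c.1 := (τ.commute_of_map ha hτa c.2).symm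
    apply Subtype.ext
    change τ.1 ^ (m.toAdd + n.toAdd) * (c.1 * d.1)
      = τ.1 ^ m.toAdd * c.1 * (τ.1 ^ n.toAdd * d.1)
    rw [zpow_add]
    have h2 : τ.1 ^ n.toAdd * c.1 = c.1 * τ.1 ^ n.toAdd := (h.zpow_left n.toAdd).eq
    calc τ.1 ^ m.toAdd * τ.1 ^ n.toAdd * (c.1 * d.1)
        = τ.1 ^ m.toAdd * (τ.1 ^ n.toAdd * c.1) * d.1 := by group
      _ = τ.1 ^ m.toAdd * c.1 * (τ.1 ^ n.toAdd * d.1) := by rw [h2]; group)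

theorem Reflections.zpow_apply {W : Subgroup (V ≃ₗ[ℚ_[2]] V)} (τ : Reflections W)
    {a : V} (hτa : τ.1.1 a = -a) (n : ℤ) :
    (Even n → (τ.1 ^ n).1 a = a) ∧ (Odd n → (τ.1 ^ n).1 a = -a) := by
  have hsq : (τ.1 * τ.1).1 a = a := by
    change τ.1.1 (τ.1.1 a) = a
    rw [hτa, map_neg, hτa, neg_neg]
  have hst : τ.1 * τ.1 ∈ MulAction.stabilizer W a := hsq
  have heven : ∀ k : ℤ, (τ.1 ^ (k + k)).1 a = a := by
    intro k
    have h1 : τ.1 ^ (k + k) = (τ.1 * τ.1) ^ k := by rw [← two_mul, zpow_mul, zpow_two]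
    rw [h1]
    exact (MulAction.stabilizer W a).zpow_mem hst k
  constructor
  · rintro ⟨k, rfl⟩
    exact heven k
  · rintro ⟨k, rfl⟩
    rw [two_mul, add_comm, zpow_add, zpow_one]
    change τ.1.1 ((τ.1 ^ (k + k)).1 a) = -a
    rw [heven, hτa]

theorem ne_neg_self {a : V} (ha : a ≠ 0) : a ≠ -a := by
  intro h
  have h2 : (2 : ℚ_[2]) • a = 0 := by rw [two_smul]; nth_rewrite 1 [h]; abel
  exact smul_ne_zero two_ne_zero ha h2

/-- A reflection in a finite group is an involution. -/
theorem Reflections.mul_self {W : Subgroup (V ≃ₗ[ℚ_[2]] V)} [Finite W] (τ : Reflections W) :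
    τ.1 * τ.1 = 1 := by
  obtain ⟨a, ha, hτa⟩ := τ.exists_neg
  obtain ⟨f, hf⟩ := τ.form ha hτa
  have hv : ∀ v, (τ.1 * τ.1).1 v = v - (f v + f (τ.1.1 v)) • a := by
    intro v
    change τ.1.1 (τ.1.1 v) = _
    rw [hf (τ.1.1 v)]
    rw [add_smul, ← sub_sub, ← hf v]
  have hva : (τ.1 * τ.1).1 a = a := by
    change τ.1.1 (τ.1.1 a) = _
    rw [hτa, map_neg, hτa, neg_neg]
  obtain ⟨m, hm, hm1⟩ := exists_pow_eq_one_val (τ.1 * τ.1)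
  exact Subtype.ext (LinearEquiv.ext (transvection_finite_order hv hva hm hm1))

theorem Reflections.zpow_even {W : Subgroup (V ≃ₗ[ℚ_[2]] V)} [Finite W] (τ : Reflections W)
    {n : ℤ} (hn : Even n) : τ.1 ^ n = 1 := by
  obtain ⟨k, rfl⟩ := hn
  rw [← two_mul, zpow_mul, zpow_two, τ.mul_self, one_zpow]

/-- The extension `1 → ℤ → ℤ × C^⊥ → C → 1` with left map `m ↦ (2m, 1)`. -/
noncomputable def centralizerExtension {W : Subgroup (V ≃ₗ[ℚ_[2]] V)} [Finite W]
    (τ : Reflections W) {a : V} (ha : a ≠ 0) (hτa : τ.1.1 a = -a) :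
    GroupExtension (Multiplicative ℤ) (Multiplicative ℤ × MulAction.stabilizer W a)
      (Subgroup.centralizer {τ.1}) where
  inl := (MonoidHom.inl (Multiplicative ℤ) (MulAction.stabilizer W a)).comp (powMonoidHom 2)
  rightHom := centralizerHom τ ha hτa
  inl_injective := by
    intro m n h
    have h1 : m ^ 2 = n ^ 2 := congrArg Prod.fst h
    have h2 : 2 * m.toAdd = 2 * n.toAdd := by simpa using congrArg Multiplicative.toAdd h1
    apply Multiplicative.toAdd.injective
    omega
  range_inl_eq_ker_rightHom := by
    ext ⟨n, c⟩
    rw [MonoidHom.mem_range, MonoidHom.mem_ker]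
    constructor
    · rintro ⟨m, hm⟩
      have h1 : m ^ 2 = n := congrArg Prod.fst hm
      have h2 : 1 = c := congrArg Prod.snd hm
      subst h1 h2
      apply Subtype.ext
      change τ.1 ^ (m ^ 2).toAdd * 1 = 1
      rw [mul_one, toAdd_pow]
      exact τ.zpow_even (by simp)
    · intro h
      have h1 : τ.1 ^ n.toAdd * c.1 = 1 := congrArg Subtype.val h
      have hc : c.1.1 a = a := c.2
      have h2 : (τ.1 ^ n.toAdd).1 a = a := by
        have h3 : (τ.1 ^ n.toAdd * c.1).1 a = a := by rw [h1]; rfl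
        have h4 : (τ.1 ^ n.toAdd).1 (c.1.1 a) = a := h3
        rwa [hc] at h4
      have he : Even n.toAdd := by
        by_contra ho
        rw [Int.not_even_iff_odd] at ho
        rw [(τ.zpow_apply hτa _).2 ho] at h2
        exact ne_neg_self ha h2.symm
      rw [τ.zpow_even he, one_mul] at h1
      obtain ⟨k, hk⟩ := he
      refine ⟨Multiplicative.ofAdd k, Prod.ext ?_ (Subtype.ext h1.symm)⟩
      change (Multiplicative.ofAdd k) ^ 2 = n
      apply Multiplicative.toAdd.injective
      rw [toAdd_pow, toAdd_ofAdd, hk, two_smul]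
  rightHom_surjective := by
    rintro ⟨w, hw⟩
    rw [Subgroup.mem_centralizer_singleton_iff] at hw
    rcases τ.map_of_commute ha hτa hw with h | h
    · refine ⟨(1, ⟨w, h⟩), Subtype.ext ?_⟩
      change τ.1 ^ (0 : ℤ) * w = w
      rw [zpow_zero, one_mul]
    · refine ⟨(Multiplicative.ofAdd 1, ⟨τ.1 * w, ?_⟩), Subtype.ext ?_⟩
      · change τ.1.1 (w.1 a) = a
        rw [h, map_neg, hτa, neg_neg]
      · change τ.1 ^ (1 : ℤ) * (τ.1 * w) = w
        rw [zpow_one, ← mul_assoc, τ.mul_self, one_mul]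

/-! ### The reflection extension -/

/-- Given extensions `1 → A → E → G → 1` and `1 → B → E' → H → 1` with `A`, `B` abelian and
`H ≤ G`, and a homomorphism `f : A → B`, this says that the extension of `H` obtained from the first
one by pulling back along `H → G` and pushing forward along `f` is equivalent to the second one,
i.e. there is a morphism of extensions from the pullback to the second one which is `f` on kernels
and the identity on `H`. In cohomological terms, `H²(G; A) → H²(H; A) → H²(H; B)` maps the class of
the first extension to the class of the second. -/
def IsRestrictedPushforward {A B G E E' : Type*} [CommGroup A] [CommGroup B] [Group G] [Group E]
    [Group E'] {H : Subgroup G} (S : GroupExtension A E G) (f : A →* B)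
    (S' : GroupExtension B E' H) : Prop :=
  ∃ φ : H.comap S.rightHom →* E',
    (∀ n : A, ∀ hn : S.inl n ∈ H.comap S.rightHom, φ ⟨S.inl n, hn⟩ = S'.inl (f n)) ∧
    ∀ x : H.comap S.rightHom, (S'.rightHom (φ x) : G) = S.rightHom x

/-- The homomorphism `ℤ[Σ] → ℤ` taking the coefficient of `τ`. -/
noncomputable def reflCoeff {W : Subgroup (V ≃ₗ[ℚ_[2]] V)} (τ : Reflections W) :
    Multiplicative (ReflModule W) →* Multiplicative ℤ :=
  AddMonoidHom.toMultiplicative (Finsupp.applyAddHom τ)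

/-- `1 → ℤ[Σ] → R → W → 1` is (a representative of the equivalence class of) the reflection
extension `ρ(W)`. The action of `W` on the kernel is the permutation action on `ℤ[Σ]`. The class of
the extension in `H²(W; ℤ[Σ]) = ⨁ᵢ H²(W; ℤ[Σᵢ])`, where `Σᵢ` runs over the conjugacy classes of
reflections, is the one whose `i`-th component corresponds to the class of
`1 → ℤ → ℤ × Cᵢ^⊥ → Cᵢ → 1` under Shapiro's isomorphism `H²(W; ℤ[Σᵢ]) ≅ H²(Cᵢ; ℤ)`, for a choice of
`τᵢ ∈ Σᵢ` with centralizer `Cᵢ` and of `aᵢ ≠ 0` with `τᵢ aᵢ = -aᵢ`; Shapiro's isomorphism is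
restriction to `Cᵢ` followed by the coefficient map `ℤ[Σᵢ] → ℤ` at `τᵢ`. -/
structure IsReflectionExtension {W : Subgroup (V ≃ₗ[ℚ_[2]] V)} [Finite W] {R : Type*} [Group R]
    (S : GroupExtension (Multiplicative (ReflModule W)) R W) : Prop where
  conj_inl : ∀ (x : R) (u : ReflModule W),
    x * S.inl (Multiplicative.ofAdd u) * x⁻¹ =
      S.inl (Multiplicative.ofAdd (reflAct (S.rightHom x) u))
  shapiro : ∀ σ : Reflections W, ∃ τ : Reflections W, IsConj σ.1 τ.1 ∧
    ∃ (a : V) (ha : a ≠ 0) (hτa : τ.1.1 a = -a),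
      IsRestrictedPushforward S (reflCoeff τ) (centralizerExtension τ ha hτa)

/-! ### Existence of the reflection extension -/

theorem Reflections.exists_roots (W : Subgroup (V ≃ₗ[ℚ_[2]] V)) [Finite W] :
    ∃ b : Reflections W → V, (∀ s, b s ≠ 0) ∧ (∀ s, s.1.1 (b s) = -b s) ∧
      ∀ (w : W) (s : Reflections W), w.1 (b s) = b (w • s) ∨ w.1 (b s) = -b (w • s) := by
  have h1 : ∀ s : Reflections W, ∃ g : W,
      g • (Quotient.out (Quotient.mk (MulAction.orbitRel W (Reflections W)) s)) = s := by
    intro s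
    have h := Quotient.mk_out (s := MulAction.orbitRel W (Reflections W)) s
    exact (MulAction.orbitRel W (Reflections W)).symm h
  choose g hg using h1
  choose a ha hna using fun s : Reflections W => s.exists_neg
  let r : Reflections W → Reflections W := fun s =>
    Quotient.out (Quotient.mk (MulAction.orbitRel W (Reflections W)) s)
  have hr : ∀ (w : W) s, r (w • s) = r s := by
    intro w s
    have : Quotient.mk (MulAction.orbitRel W (Reflections W)) (w • s) =
        Quotient.mk (MulAction.orbitRel W (Reflections W)) s := Quotient.sound ⟨w, rfl⟩
    simp only [r, this]
  have hg' : ∀ s, g s • r s = s := hg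
  refine ⟨fun s => (g s).1 (a (r s)), fun s => ?_, fun s => ?_, fun w s => ?_⟩
  · simpa using ha (r s)
  · have h2 : s.1 = g s * (r s).1 * (g s)⁻¹ := by
      rw [← Reflections.smul_val, hg' s]
    have h3 : s.1 * g s = g s * (r s).1 := by
      nth_rewrite 1 [h2]; group
    have h4 : (s.1 * g s).1 (a (r s)) = (g s * (r s).1).1 (a (r s)) := by rw [h3]
    have h5 : s.1.1 ((g s).1 (a (r s))) = (g s).1 ((r s).1.1 (a (r s))) := h4
    rw [h5, hna, map_neg]
  · have h2 : ((g (w • s))⁻¹ * w * g s) • r s = r s := by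
      rw [mul_smul, mul_smul, hg' s, inv_smul_eq_iff, ← hr w s, hg']
    have h3 : ((g (w • s))⁻¹ * w * g s) * (r s).1 =
        (r s).1 * ((g (w • s))⁻¹ * w * g s) := by
      have h4 := congrArg Subtype.val h2
      rw [Reflections.smul_val] at h4
      exact mul_inv_eq_iff_eq_mul.1 h4
    have h5 := (r s).map_of_commute (ha (r s)) (hna (r s)) h3
    have h6 : ∀ v, (g (w • s)).1 (((g (w • s))⁻¹ * w * g s).1 v) = w.1 ((g s).1 v) := by
      intro v
      change ((g (w • s)) * ((g (w • s))⁻¹ * w * g s)).1 v = (w * g s).1 v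
      congr 2
      group
    dsimp only
    rw [← h6, hr]
    rcases h5 with h | h
    · left; rw [h]
    · right; rw [h, map_neg]

/-- The permutation action of `W` on `ℤ[Σ]`, written multiplicatively. -/
noncomputable def reflAut (W : Subgroup (V ≃ₗ[ℚ_[2]] V)) :
    W →* MulAut (Multiplicative (ReflModule W)) where
  toFun w := AddEquiv.toMultiplicative (Finsupp.domCongr (MulAction.toPerm w))
  map_one' := by
    ext u s
    change u.toAdd ((1 : W)⁻¹ • s) = u.toAdd s
    rw [inv_one, one_smul]
  map_mul' w w' := by
    ext u s
    change u.toAdd ((w * w')⁻¹ • s) = u.toAdd (w'⁻¹ • w⁻¹ • s)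
    rw [mul_inv_rev, mul_smul]

theorem reflAut_apply {W : Subgroup (V ≃ₗ[ℚ_[2]] V)} (w : W) (u : Multiplicative (ReflModule W))
    (s : Reflections W) : (reflAut W w u).toAdd s = u.toAdd (w⁻¹ • s) := rfl

theorem reflAct_apply {W : Subgroup (V ≃ₗ[ℚ_[2]] V)} (w : W) (u : ReflModule W)
    (s : Reflections W) : reflAct w u s = u (w⁻¹ • s) := by
  have h := Finsupp.mapDomain_apply (MulAction.injective w) u (w⁻¹ • s)
  rw [smul_inv_smul] at h
  exact h

/-- Given a choice of roots `b`, the subgroup of all `(n, w) ∈ ℤ[Σ] ⋊ W` such that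
`w b_{w⁻¹sw} = (-1)^{n(s)} b_s` for all reflections `s`. -/
noncomputable def reflModel {W : Subgroup (V ≃ₗ[ℚ_[2]] V)} (b : Reflections W → V) :
    Subgroup (Multiplicative (ReflModule W) ⋊[reflAut W] W) where
  carrier := {x | ∀ s, x.right.1 (b (x.right⁻¹ • s)) = (-1 : ℚ_[2]) ^ (x.left.toAdd s) • b s}
  one_mem' := by
    intro s
    change b ((1 : W)⁻¹ • s) = (-1 : ℚ_[2]) ^ (0 : ℤ) • b s
    rw [inv_one, one_smul, zpow_zero, one_smul]
  mul_mem' := by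
    intro x y hx hy s
    change x.right.1 (y.right.1 (b ((x.right * y.right)⁻¹ • s))) =
      (-1 : ℚ_[2]) ^ (x.left.toAdd s + y.left.toAdd (x.right⁻¹ • s)) • b s
    rw [mul_inv_rev, mul_smul, hy, map_smul, hx, smul_smul,
      zpow_add₀ (neg_ne_zero.2 one_ne_zero), mul_comm]
  inv_mem' := by
    intro x hx s
    change x.right.1.symm (b (x.right⁻¹⁻¹ • s)) =
      (-1 : ℚ_[2]) ^ (-(x.left.toAdd (x.right⁻¹⁻¹ • s))) • b s
    rw [inv_inv, LinearEquiv.symm_apply_eq, map_smul]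
    have h := hx (x.right • s)
    rw [inv_smul_smul] at h
    rw [h, smul_smul, ← zpow_add₀ (neg_ne_zero.2 one_ne_zero), neg_add_cancel, zpow_zero,
      one_smul]

theorem neg_one_zpow_smul (n : ℤ) (v : V) :
    (Even n → (-1 : ℚ_[2]) ^ n • v = v) ∧ (Odd n → (-1 : ℚ_[2]) ^ n • v = -v) :=
  ⟨fun h => by rw [h.neg_one_zpow, one_smul], fun h => by rw [h.neg_one_zpow, neg_one_smul]⟩

/-- The reflection extension of a finite group exists. -/
theorem exists_isReflectionExtension (W : Subgroup (V ≃ₗ[ℚ_[2]] V)) [Finite W] :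
    ∃ (R : Subgroup (Multiplicative (ReflModule W) ⋊[reflAut W] W))
      (S : GroupExtension (Multiplicative (ReflModule W)) R W), IsReflectionExtension S := by
  classical
  obtain ⟨b, hb, hbn, hbw⟩ := Reflections.exists_roots W
  refine ⟨reflModel b,
    { inl := ((SemidirectProduct.inl).comp (powMonoidHom 2)).codRestrict (reflModel b) ?_
      rightHom := (SemidirectProduct.rightHom).comp (reflModel b).subtype
      inl_injective := ?_
      range_inl_eq_ker_rightHom := ?_
      rightHom_surjective := ?_ }, ?_, ?_⟩
  · intro u s
    change b ((1 : W)⁻¹ • s) = (-1 : ℚ_[2]) ^ (2 • u.toAdd s) • b s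
    rw [inv_one, one_smul, (neg_one_zpow_smul _ _).1 (by simp)]
  · intro u v h
    have h1 : u ^ 2 = v ^ 2 := congrArg (fun x => x.1.left) h
    apply Multiplicative.toAdd.injective
    ext s
    have h2 : 2 • u.toAdd s = 2 • v.toAdd s :=
      congrArg (fun x : Multiplicative (ReflModule W) => x.toAdd s) h1
    simpa using h2
  · ext ⟨⟨n, w⟩, hx⟩
    rw [MonoidHom.mem_range, MonoidHom.mem_ker]
    constructor
    · rintro ⟨u, hu⟩
      exact (congrArg (fun x => x.1.right) hu).symm
    · intro hw
      have hw' : w = 1 := hw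
      subst hw'
      have hev : ∀ s, Even (n.toAdd s) := by
        intro s
        by_contra ho
        rw [Int.not_even_iff_odd] at ho
        have h1 : b ((1 : W)⁻¹ • s) = (-1 : ℚ_[2]) ^ (n.toAdd s) • b s := hx s
        rw [inv_one, one_smul, (neg_one_zpow_smul _ _).2 ho] at h1
        exact ne_neg_self (hb s) h1
      refine ⟨Multiplicative.ofAdd (n.toAdd.mapRange (fun k => k / 2) (by simp)), ?_⟩
      apply Subtype.ext
      refine SemidirectProduct.ext ?_ rfl
      apply Multiplicative.toAdd.injective
      ext s
      change 2 • (n.toAdd s / 2) = n.toAdd s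
      obtain ⟨k, hk⟩ := hev s
      rw [hk, two_smul]
      omega
  · intro w
    refine ⟨⟨⟨Multiplicative.ofAdd (Finsupp.equivFunOnFinite.symm
      (fun s => if w.1 (b (w⁻¹ • s)) = b s then 0 else 1)), w⟩, ?_⟩, rfl⟩
    intro s
    change w.1 (b (w⁻¹ • s)) =
      (-1 : ℚ_[2]) ^ (if w.1 (b (w⁻¹ • s)) = b s then (0 : ℤ) else 1) • b s
    split_ifs with h
    · rw [zpow_zero, one_smul, h]
    · have h1 := hbw w (w⁻¹ • s)
      rw [smul_inv_smul] at h1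
      rw [zpow_one, neg_one_smul]
      exact h1.resolve_left h
  · rintro ⟨⟨n, w⟩, hx⟩ u
    rw [mul_inv_eq_iff_eq_mul]
    apply Subtype.ext
    refine SemidirectProduct.ext ?_ ?_
    · apply Multiplicative.toAdd.injective
      ext s
      change n.toAdd s + 2 • u (w⁻¹ • s) = 2 • (reflAct w u s) + n.toAdd ((1 : W)⁻¹ • s)
      rw [reflAct_apply, inv_one, one_smul, add_comm]
    · change w * 1 = 1 * w
      rw [mul_one, one_mul]
  · intro σ
    refine ⟨σ, IsConj.refl _, b σ, hb σ, hbn σ, ?_⟩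
    have hfix : ∀ w : W, w * σ.1 = σ.1 * w → w⁻¹ • σ = σ := by
      intro w hw
      rw [inv_smul_eq_iff]
      apply Subtype.ext
      rw [Reflections.smul_val, hw, mul_inv_cancel_right]
    refine ⟨MonoidHom.mk' (fun x => (Multiplicative.ofAdd (x.1.1.left.toAdd σ),
      ⟨σ.1 ^ (-(x.1.1.left.toAdd σ)) * x.1.1.right, ?_⟩)) ?_, ?_, ?_⟩
    · obtain ⟨⟨⟨n, w⟩, hx⟩, hw⟩ := x
      have hw' : w * σ.1 = σ.1 * w := Subgroup.mem_centralizer_singleton_iff.1 hw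
      have h1 : w.1 (b (w⁻¹ • σ)) = (-1 : ℚ_[2]) ^ (n.toAdd σ) • b σ := hx σ
      rw [hfix w hw'] at h1
      change (σ.1 ^ (-(n.toAdd σ))).1 (w.1 (b σ)) = b σ
      rw [h1]
      rcases Int.even_or_odd (n.toAdd σ) with h | h
      · rw [(neg_one_zpow_smul _ _).1 h, (σ.zpow_apply (hbn σ) _).1 h.neg]
      · rw [(neg_one_zpow_smul _ _).2 h, map_neg, (σ.zpow_apply (hbn σ) _).2 h.neg, neg_neg]
    · rintro ⟨⟨⟨n, w⟩, hx⟩, hw⟩ ⟨⟨⟨m, v⟩, hy⟩, hv⟩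
      have hw' : w * σ.1 = σ.1 * w := Subgroup.mem_centralizer_singleton_iff.1 hw
      have hcomm : w * σ.1 ^ (-(m.toAdd σ)) = σ.1 ^ (-(m.toAdd σ)) * w :=
        (Commute.zpow_right (show Commute w σ.1 from hw') _).eq
      have hadd : n.toAdd σ + m.toAdd (w⁻¹ • σ) = n.toAdd σ + m.toAdd σ := by
        rw [hfix w hw']
      refine Prod.ext ?_ (Subtype.ext ?_)
      · exact congrArg Multiplicative.ofAdd hadd
      · change σ.1 ^ (-(n.toAdd σ + m.toAdd (w⁻¹ • σ))) * (w * v) =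
          σ.1 ^ (-(n.toAdd σ)) * w * (σ.1 ^ (-(m.toAdd σ)) * v)
        rw [hadd, neg_add, zpow_add]
        calc σ.1 ^ (-(n.toAdd σ)) * σ.1 ^ (-(m.toAdd σ)) * (w * v)
            = σ.1 ^ (-(n.toAdd σ)) * (σ.1 ^ (-(m.toAdd σ)) * w) * v := by
              simp only [mul_assoc]
          _ = σ.1 ^ (-(n.toAdd σ)) * w * (σ.1 ^ (-(m.toAdd σ)) * v) := by
              rw [← hcomm]; simp only [mul_assoc]
    · intro u hu
      refine Prod.ext rfl (Subtype.ext ?_)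
      change σ.1 ^ (-(2 • u.toAdd σ)) * 1 = 1
      rw [mul_one]
      exact σ.zpow_even (by simp)
    · rintro ⟨⟨⟨n, w⟩, hx⟩, hw⟩
      change σ.1 ^ (n.toAdd σ) * (σ.1 ^ (-(n.toAdd σ)) * w) = w
      rw [← mul_assoc, ← zpow_add, add_neg_cancel, zpow_zero, one_mul]

/-! ### Square roots of reflections -/

/-- `C_σ = (1 - σ) ℤ[Σ]`. -/
noncomputable def reflC {W : Subgroup (V ≃ₗ[ℚ_[2]] V)} (σ : Reflections W) :
    AddSubgroup (ReflModule W) :=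
  (AddMonoidHom.id (ReflModule W) - reflAct σ.1).range

/-- `Q_σ`, the set of `x` in the group `R` with `x² = σ ∈ ℤ[Σ]`. -/
def reflQ {W : Subgroup (V ≃ₗ[ℚ_[2]] V)} {R : Type*} [Group R]
    (S : GroupExtension (Multiplicative (ReflModule W)) R W) (σ : Reflections W) : Set R :=
  {x | x ^ 2 = S.inl (Multiplicative.ofAdd (Finsupp.single σ 1))}

/-- A subgroup of `ℤ[Σ]` viewed as a subgroup of the middle group `R` of the extension. -/
noncomputable def kerSubgroup {W : Subgroup (V ≃ₗ[ℚ_[2]] V)} {R : Type*} [Group R]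
    (S : GroupExtension (Multiplicative (ReflModule W)) R W) (C : AddSubgroup (ReflModule W)) :
    Subgroup R :=
  (AddSubgroup.toSubgroup C).map S.inl

end ReflectionGroups

/-! Restricting the extension to the centralizer of a reflection τ gives an additive degree ψ_τ on
the elements of ρ(W) lying over it (`IsReflectionExtension.exists_degree`). On ℤ[Σ] it is twice the
coefficient at τ, and ψ_τ(x) is odd exactly when π(x) negates a root of τ. Hence, if x² lies in ℤ[Σ]
and π(x) negates a root of τ, then the coefficient of x² at τ equals ψ_τ(x), which is odd. This
parity argument gives everything about π(Q_σ) and about involutions, provided that enough roots are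
negated.

The supply of roots is `exists_reflection_neg`: every involution in W negates the root of some
reflection that fixes all its fixed vectors. It rests on Steinberg's theorem that a vector lying on
no reflecting hyperplane has trivial stabilizer (`eq_one_of_apply_eq`). For that, let I be the ideal
generated by the homogeneous invariants of positive degree and N a graded complement of I. If v lies
on no reflecting hyperplane, the leading form of a polynomial vanishing on Wv lies in I, so N embeds
into the functions on W by evaluation along the orbit of v. For a v₀ with trivial stabilizer,
evaluation maps N onto these functions, because invariants are constant on orbits and span the
polynomial ring together with N. Comparing dimensions, evaluation along the orbit of v is onto as
well, which forces the orbit to be free.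

The rest is the cohomology of ⟨σ⟩ in the permutation module ℤ[Σ] (`exists_add_smul_reflAct_eq`).
Vanishing in the sign-twisted case is C_σ = ker(1 + σ). In the untwisted case the only obstruction
to being a norm is the parity of the coefficients at fixed reflections, and the degrees show that it
vanishes for the correction turning a lift of σ into a square root of σ. -/

section PolynomialInvariants

/-! ### Homogeneous components, interpolation and linear substitutions -/

open MvPolynomial

variable {K V ι : Type*} [Field K]

theorem homogeneousComponent_add_mul {p : MvPolynomial ι K} {j : ℕ} (hp : p.IsHomogeneous j)
    (q : MvPolynomial ι K) (d : ℕ) :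
    homogeneousComponent (d + j) (q * p) = homogeneousComponent d q * p := by
  have h1 : ∀ i, homogeneousComponent (d + j) (homogeneousComponent i q * p) =
      if i = d then homogeneousComponent d q * p else 0 := by
    intro i
    rw [homogeneousComponent_of_mem ((homogeneousComponent_isHomogeneous i q).mul hp)]
    by_cases h : i = d
    · simp [h]
    · rw [if_neg (by omega), if_neg h]
  conv_lhs => rw [← sum_homogeneousComponent q, Finset.sum_mul, map_sum]
  rw [Finset.sum_congr rfl fun i _ => h1 i, Finset.sum_ite_eq']
  split_ifs with h
  · rfl
  · rw [homogeneousComponent_eq_zero _ _ (by simpa using h), zero_mul]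

theorem homogeneousComponent_mul_of_lt {p : MvPolynomial ι K} {j d : ℕ} (hp : p.IsHomogeneous j)
    (h : d < j) (q : MvPolynomial ι K) : homogeneousComponent d (q * p) = 0 := by
  conv_lhs => rw [← sum_homogeneousComponent q, Finset.sum_mul, map_sum]
  refine Finset.sum_eq_zero fun i _ => ?_
  rw [homogeneousComponent_of_mem ((homogeneousComponent_isHomogeneous i q).mul hp),
    if_neg (by omega)]

/-- Interpolation: for each u ≠ x some coordinate separates `p u` from `p x`, giving a polynomial of
degree one that vanishes at `p u` and equals 1 at `p x`; these are multiplied together. -/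
theorem exists_eval_eq_single {α : Type*} [Fintype α] [DecidableEq α] {p : α → ι → K}
    (hp : Function.Injective p) (x : α) :
    ∃ f : MvPolynomial ι K, ∀ y, eval (p y) f = (Pi.single x 1 : α → K) y := by
  have h : ∀ u, ∃ f : MvPolynomial ι K, eval (p x) f = 1 ∧ (u ≠ x → eval (p u) f = 0) := by
    intro u
    by_cases hu : u = x
    · exact ⟨1, by simp, fun h => absurd hu h⟩
    obtain ⟨i, hi⟩ := Function.ne_iff.1 (hp.ne hu)
    refine ⟨C ((p x i - p u i)⁻¹) * (X i - C (p u i)), ?_, fun _ => by simp⟩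
    simp only [map_mul, eval_C, map_sub, eval_X]
    exact inv_mul_cancel₀ (sub_ne_zero.2 (Ne.symm hi))
  choose f hf1 hf0 using h
  refine ⟨∏ u, f u, fun y => ?_⟩
  rw [map_prod]
  by_cases hy : y = x
  · subst hy
    simp [hf1]
  · rw [Pi.single_eq_of_ne hy]
    exact Finset.prod_eq_zero (Finset.mem_univ y) (hf0 y hy)

variable [AddCommGroup V] [Module K V] [Fintype ι]

/-- A linear form as a polynomial in the coordinates with respect to a basis. -/
noncomputable def linForm (b : Module.Basis ι K V) (l : Module.Dual K V) : MvPolynomial ι K :=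
  ∑ j, C (l (b j)) * X j

theorem linForm_isHomogeneous (b : Module.Basis ι K V) (l : Module.Dual K V) :
    (linForm b l).IsHomogeneous 1 :=
  IsHomogeneous.sum _ _ _ fun j _ => isHomogeneous_C_mul_X _ j

theorem eval_linForm (b : Module.Basis ι K V) (l : Module.Dual K V) (v : V) :
    eval (b.equivFun v) (linForm b l) = l v := by
  conv_rhs => rw [← b.sum_equivFun v]
  simp only [linForm, map_sum, map_mul, eval_C, eval_X, map_smul, smul_eq_mul, mul_comm]

/-- The action of linear automorphisms on polynomials by substitution. -/
noncomputable def linSubst (b : Module.Basis ι K V) (g : V ≃ₗ[K] V) :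
    MvPolynomial ι K →ₐ[K] MvPolynomial ι K :=
  aeval fun i => linForm b (b.coord i ∘ₗ g.toLinearMap)

theorem eval_linSubst (b : Module.Basis ι K V) (g : V ≃ₗ[K] V) (v : V) (f : MvPolynomial ι K) :
    eval (b.equivFun v) (linSubst b g f) = eval (b.equivFun (g v)) f := by
  induction f using MvPolynomial.induction_on with
  | C a => simp [linSubst]
  | add p q hp hq => rw [map_add, map_add, map_add, hp, hq]
  | mul_X p i hp =>
    rw [map_mul, map_mul, map_mul, hp, eval_X, linSubst, aeval_X, eval_linForm]
    rfl

/-- Over an infinite field, identities between substitutions can be checked on vectors. -/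
theorem eq_of_eval_equivFun [Infinite K] (b : Module.Basis ι K V) {p q : MvPolynomial ι K}
    (h : ∀ v, eval (b.equivFun v) p = eval (b.equivFun v) q) : p = q :=
  MvPolynomial.funext fun x => by
    have h1 := h (b.equivFun.symm x)
    rwa [LinearEquiv.apply_symm_apply] at h1

theorem linSubst_mul [Infinite K] (b : Module.Basis ι K V) (g h : V ≃ₗ[K] V)
    (f : MvPolynomial ι K) : linSubst b (g * h) f = linSubst b h (linSubst b g f) :=
  eq_of_eval_equivFun b fun v => by simp only [eval_linSubst, LinearEquiv.mul_apply]

theorem linSubst_one [Infinite K] (b : Module.Basis ι K V) (f : MvPolynomial ι K) :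
    linSubst b 1 f = f :=
  eq_of_eval_equivFun b fun v => by rw [eval_linSubst, LinearEquiv.coe_one, id]

theorem linSubst_isHomogeneous (b : Module.Basis ι K V) (g : V ≃ₗ[K] V) {f : MvPolynomial ι K}
    {d : ℕ} (hf : f.IsHomogeneous d) : (linSubst b g f).IsHomogeneous d := by
  have h := hf.aeval _ (n := 1) fun i => linForm_isHomogeneous b (b.coord i ∘ₗ g.toLinearMap)
  rwa [one_mul] at h

theorem homogeneousComponent_linSubst (b : Module.Basis ι K V) (g : V ≃ₗ[K] V)
    (f : MvPolynomial ι K) (d : ℕ) :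
    homogeneousComponent d (linSubst b g f) = linSubst b g (homogeneousComponent d f) := by
  conv_lhs => rw [← sum_homogeneousComponent f, map_sum, map_sum]
  rw [Finset.sum_congr rfl fun i _ => homogeneousComponent_of_mem
    (linSubst_isHomogeneous b g (homogeneousComponent_isHomogeneous i f)), Finset.sum_ite_eq]
  split_ifs with h
  · rfl
  · rw [homogeneousComponent_eq_zero _ _ (by simpa using h), map_zero]

/-- For `s v = v - l(v) a` the polynomial `f - f ∘ s` is divisible by `l`. -/
theorem linForm_dvd_sub_linSubst (b : Module.Basis ι K V) {s : V ≃ₗ[K] V} {l : Module.Dual K V}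
    {a : V} (hs : ∀ v, s v = v - l v • a) (f : MvPolynomial ι K) :
    linForm b l ∣ f - linSubst b s f := by
  rw [← Ideal.mem_span_singleton]
  -- Modulo `l` the substitution by `s` is the identity; as both sides are algebra maps, it suffices
  -- to compare them on the variables.
  have key : (Ideal.Quotient.mkₐ K (Ideal.span {linForm b l})) =
      (Ideal.Quotient.mkₐ K (Ideal.span {linForm b l})).comp (linSubst b s) := by
    refine MvPolynomial.algHom_ext fun i => ?_
    rw [AlgHom.comp_apply, Ideal.Quotient.mkₐ_eq_mk, Ideal.Quotient.eq,
      Ideal.mem_span_singleton]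
    refine ⟨C (b.coord i a), ?_⟩
    simp only [linSubst, aeval_X, linForm, LinearMap.comp_apply, LinearEquiv.coe_coe, hs, map_sub,
      map_smul, smul_eq_mul, C_mul, sub_mul, Finset.sum_sub_distrib, Finset.sum_mul]
    have h1 : ∑ j, C (b.coord i (b j)) * X j = (X i : MvPolynomial ι K) := by
      classical
      simp [Finsupp.single_apply]
    rw [h1, sub_sub_cancel]
    exact Finset.sum_congr rfl fun j _ => by ring
  exact Ideal.Quotient.eq.1 (DFunLike.congr_fun key f)

/-! ### The ideal of invariants and leading forms -/

/-- The ideal generated by the homogeneous invariants of positive degree. -/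
noncomputable def invariantIdeal (b : Module.Basis ι K V) (G : Subgroup (V ≃ₗ[K] V)) :
    Ideal (MvPolynomial ι K) :=
  Ideal.span {g | ∃ j, 0 < j ∧ g.IsHomogeneous j ∧ ∀ w ∈ G, linSubst b w g = g}

theorem linSubst_mem_invariantIdeal (b : Module.Basis ι K V) (G : Subgroup (V ≃ₗ[K] V))
    {w : V ≃ₗ[K] V} (hw : w ∈ G) {f : MvPolynomial ι K} (hf : f ∈ invariantIdeal b G) :
    linSubst b w f ∈ invariantIdeal b G := by
  have : invariantIdeal b G ≤ (invariantIdeal b G).comap (linSubst b w) := by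
    refine Ideal.span_le.2 ?_
    rintro g ⟨j, hj, hg, hgi⟩
    rw [SetLike.mem_coe, Ideal.mem_comap, hgi w hw]
    exact Ideal.subset_span ⟨j, hj, hg, hgi⟩
  exact this hf

/-- A homogeneous polynomial of positive degree lies in the ideal of invariants if it is fixed
modulo this ideal by a set of generators of the group. -/
theorem mem_invariantIdeal_of_sub_mem [CharZero K] (b : Module.Basis ι K V)
    (G : Subgroup (V ≃ₗ[K] V)) [Finite G] {T : Set (V ≃ₗ[K] V)} (hT : Subgroup.closure T = G)
    {f : MvPolynomial ι K} {d : ℕ} (hd : 0 < d) (hf : f.IsHomogeneous d)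
    (h : ∀ s ∈ T, f - linSubst b s f ∈ invariantIdeal b G) : f ∈ invariantIdeal b G := by
  -- Since the ideal is stable under the group, the elements fixing `f` modulo it form a subgroup.
  have hall : ∀ w ∈ G, f - linSubst b w f ∈ invariantIdeal b G := by
    intro w hw
    rw [← hT] at hw
    induction hw using Subgroup.closure_induction with
    | mem s hs => exact h s hs
    | one => rw [linSubst_one, sub_self]; exact zero_mem _
    | mul x y hx hy h1 h2 =>
      have h3 := linSubst_mem_invariantIdeal b G (hT ▸ hy) h1
      rw [map_sub] at h3
      rw [linSubst_mul, ← sub_add_sub_cancel f (linSubst b y f)]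
      exact add_mem h2 h3
    | inv x hx h1 =>
      have h3 := linSubst_mem_invariantIdeal b G (inv_mem (hT ▸ hx : x ∈ G)) h1
      rw [map_sub, ← linSubst_mul, mul_inv_cancel, linSubst_one] at h3
      rw [← neg_sub]
      exact neg_mem h3
  have := Fintype.ofFinite G
  -- The orbit sum is itself a homogeneous invariant of positive degree, and modulo the ideal it is
  -- |G| times `f`; |G| is invertible in characteristic zero.
  have hsum : ∑ w : G, linSubst b w.1 f ∈ invariantIdeal b G := by
    refine Ideal.subset_span ⟨d, hd, IsHomogeneous.sum _ _ _ fun w _ =>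
      linSubst_isHomogeneous b w.1 hf, fun u hu => ?_⟩
    rw [map_sum]
    simp_rw [← linSubst_mul]
    exact Fintype.sum_equiv (Equiv.mulRight ⟨u, hu⟩) _ _ fun w => by
      rw [Equiv.coe_mulRight, Subgroup.coe_mul]
  have h4 : ∑ w : G, (f - linSubst b w.1 f) ∈ invariantIdeal b G :=
    sum_mem fun w _ => hall w.1 w.2
  rw [Finset.sum_sub_distrib, Finset.sum_const, Finset.card_univ, nsmul_eq_mul] at h4
  have h5 := add_mem h4 hsum
  rw [sub_add_cancel] at h5
  have hc : (Fintype.card G : K) ≠ 0 := Nat.cast_ne_zero.2 Fintype.card_ne_zero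
  have h6 := Ideal.mul_mem_left _ (C ((Fintype.card G : K)⁻¹)) h5
  have h7 : (C ((Fintype.card G : K)⁻¹) : MvPolynomial ι K) * ((Fintype.card G : ℕ) * f) = f := by
    rw [← mul_assoc, ← map_natCast (C : K →+* MvPolynomial ι K), ← C_mul, inv_mul_cancel₀ hc,
      C_1, one_mul]
  rwa [h7] at h6

/-- The leading forms of polynomials vanishing on a regular orbit of a reflection group lie in the
ideal of invariants. -/
theorem homogeneousComponent_mem_invariantIdeal [CharZero K] (b : Module.Basis ι K V)
    (G : Subgroup (V ≃ₗ[K] V)) [Finite G] {T : Set (V ≃ₗ[K] V)} (hT : Subgroup.closure T = G)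
    (hrefl : ∀ s ∈ T, ∃ (l : Module.Dual K V) (a : V), ∀ v, s v = v - l v • a) {v : V}
    (hv : ∀ s ∈ T, ∀ w ∈ G, s (w v) ≠ w v) (d : ℕ) :
    ∀ f : MvPolynomial ι K, f.totalDegree ≤ d → (∀ w ∈ G, eval (b.equivFun (w v)) f = 0) →
      homogeneousComponent d f ∈ invariantIdeal b G := by
  induction d with
  | zero =>
    intro f hf h
    rw [nonpos_iff_eq_zero, totalDegree_eq_zero_iff_eq_C] at hf
    have h1 := h 1 (one_mem _)
    rw [hf, eval_C] at h1
    rw [hf, h1]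
    simp
  | succ d ih =>
    intro f hf h
    refine mem_invariantIdeal_of_sub_mem b G hT d.succ_pos
      (homogeneousComponent_isHomogeneous _ _) fun s hs => ?_
    obtain ⟨l, a, hl⟩ := hrefl s hs
    obtain ⟨g, hg⟩ := linForm_dvd_sub_linSubst b hl f
    rw [mul_comm] at hg
    have hl0 : ∀ w ∈ G, l (w v) ≠ 0 := fun w hw h0 => hv s hs w hw (by rw [hl, h0]; simp)
    have hlin : linForm b l ≠ 0 := by
      intro h0
      have := eval_linForm b l ((1 : V ≃ₗ[K] V) v)
      rw [h0, map_zero] at this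
      exact hl0 1 (one_mem _) this.symm
    rw [← homogeneousComponent_linSubst, ← map_sub, hg,
      homogeneousComponent_add_mul (linForm_isHomogeneous b l)]
    -- The quotient `g` of `f - f ∘ s` by `l` has degree at most `d`. It vanishes on the orbit
    -- because `f` and `f ∘ s` do while `l` has no zero there, so the induction hypothesis applies
    -- to it.
    refine Ideal.mul_mem_right _ _ (ih g ?_ fun w hw => ?_)
    · by_cases hg0 : g = 0
      · simp [hg0]
      have h1 := totalDegree_mul_of_isDomain hg0 hlin
      rw [← hg, (linForm_isHomogeneous b l).totalDegree hlin] at h1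
      have h2 : (linSubst b s f).totalDegree ≤ d + 1 := by
        rw [← sum_homogeneousComponent f, map_sum]
        refine totalDegree_finsetSum_le fun i hi => ?_
        have h3 := (linSubst_isHomogeneous b s
          (homogeneousComponent_isHomogeneous i f)).totalDegree_le
        have h4 := Finset.mem_range.1 hi
        omega
      have h3 := totalDegree_sub f (linSubst b s f)
      have h4 := max_le hf h2
      omega
    · have h1 := congrArg (eval (b.equivFun (w v))) hg
      have h2 : s * w ∈ G := mul_mem (hT ▸ Subgroup.subset_closure hs) hw
      rw [map_sub, eval_linSubst, h w hw, map_mul, eval_linForm] at h1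
      have h3 := h _ h2
      rw [LinearEquiv.mul_apply] at h3
      rw [h3, sub_self] at h1
      exact (mul_eq_zero.1 h1.symm).resolve_right (hl0 w hw)

/-- A vector space over an infinite field is not a finite union of proper subspaces, here the fixed
spaces of the nontrivial elements. -/
theorem exists_forall_apply_ne [Infinite K] (G : Subgroup (V ≃ₗ[K] V)) [Finite G] :
    ∃ v : V, ∀ w ∈ G, w v = v → w = 1 := by
  by_contra! hcon
  let p : {w : G // w ≠ 1} → Subspace K V := fun w =>
    LinearMap.eqLocus w.1.1.toLinearMap LinearMap.id
  have hcov : ⋃ i, (p i : Set V) = Set.univ := by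
    refine Set.eq_univ_of_forall fun v => ?_
    obtain ⟨w, hw, hwv, hw1⟩ := hcon v
    exact Set.mem_iUnion.2 ⟨⟨⟨w, hw⟩, fun h => hw1 (congrArg Subtype.val h)⟩, hwv⟩
  obtain ⟨w, hw⟩ := Subspace.exists_eq_top_of_iUnion_eq_univ hcov
  refine w.2 (Subtype.ext (LinearEquiv.ext fun v => ?_))
  have : v ∈ p w := hw ▸ Submodule.mem_top
  exact this

/-! ### Evaluation on orbits and freeness of the action -/

/-- Evaluation of polynomials on the orbit of a vector. -/
noncomputable def evalOrbit (b : Module.Basis ι K V) (G : Subgroup (V ≃ₗ[K] V)) (v : V) :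
    MvPolynomial ι K →ₗ[K] (G → K) :=
  LinearMap.pi fun w => (aeval (b.equivFun (w.1 v))).toLinearMap

theorem evalOrbit_apply (b : Module.Basis ι K V) (G : Subgroup (V ≃ₗ[K] V)) (v : V)
    (f : MvPolynomial ι K) (w : G) : evalOrbit b G v f w = eval (b.equivFun (w.1 v)) f := by
  rw [← aeval_eq_eval]
  rfl

theorem evalOrbit_surjective [Infinite K] (b : Module.Basis ι K V) (G : Subgroup (V ≃ₗ[K] V))
    [Finite G] {v : V} (hv : ∀ w ∈ G, w v = v → w = 1) :
    Function.Surjective (evalOrbit b G v) := by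
  classical
  have := Fintype.ofFinite G
  have hinj : Function.Injective fun w : G => (b.equivFun (w.1 v) : ι → K) := by
    intro w u h
    have h1 : w.1 v = u.1 v := b.equivFun.injective h
    have h2 := hv (u.1⁻¹ * w.1) (mul_mem (inv_mem u.2) w.2) (by
      rw [LinearEquiv.mul_apply, h1]
      exact u.1.symm_apply_apply v)
    exact Subtype.ext (inv_mul_eq_one.1 h2).symm
  rw [← LinearMap.range_eq_top, eq_top_iff]
  intro F _
  rw [← Finset.univ_sum_single F]
  refine sum_mem fun w _ => ?_
  obtain ⟨f, hf⟩ := exists_eval_eq_single hinj w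
  refine ⟨F w • f, funext fun y => ?_⟩
  rw [map_smul, Pi.smul_apply, evalOrbit_apply, hf, ← Pi.smul_apply, ← Pi.single_smul,
    smul_eq_mul, mul_one]

/-- A graded complement of the ideal of invariants generates the polynomial ring as a module over
the ring of invariants. -/
theorem span_invariant_mul_eq_top (b : Module.Basis ι K V) (G : Subgroup (V ≃ₗ[K] V))
    {H : ℕ → Submodule K (MvPolynomial ι K)}
    (hH : ∀ d, IsCompl ((invariantIdeal b G).restrictScalars K ⊓ homogeneousSubmodule ι K d) (H d)) :
    Submodule.span K {p | ∃ g h : MvPolynomial ι K, (∀ w ∈ G, linSubst b w g = g) ∧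
      (∀ d, homogeneousComponent d h ∈ H d) ∧ p = g * h} = ⊤ := by
  set M := Submodule.span K {p | ∃ g h : MvPolynomial ι K, (∀ w ∈ G, linSubst b w g = g) ∧
      (∀ d, homogeneousComponent d h ∈ H d) ∧ p = g * h} with hM
  have hmul : ∀ g : MvPolynomial ι K, (∀ w ∈ G, linSubst b w g = g) → ∀ p ∈ M, p * g ∈ M := by
    intro g hg p hp
    induction hp using Submodule.span_induction with
    | mem x hx =>
      obtain ⟨g', h, hg', hh, rfl⟩ := hx
      refine Submodule.subset_span ⟨g' * g, h, fun w hw => ?_, hh, by ring⟩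
      rw [map_mul, hg w hw, hg' w hw]
    | zero => rw [zero_mul]; exact zero_mem _
    | add x y _ _ h1 h2 => rw [add_mul]; exact add_mem h1 h2
    | smul c x _ h1 => rw [smul_mul_assoc]; exact M.smul_mem c h1
  have key : ∀ d, ∀ f : MvPolynomial ι K, f.IsHomogeneous d → f ∈ M := by
    intro d
    induction d using Nat.strong_induction_on with
    | _ d ih =>
      intro f hf
      obtain ⟨a, ha, c, hc, hac⟩ := Submodule.mem_sup.1
        ((hH d).sup_eq_top.symm ▸ Submodule.mem_top : f ∈ _ ⊔ H d)
      have hcd : c.IsHomogeneous d := by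
        rw [← add_sub_cancel_left a c, hac]
        exact hf.sub ha.2
      rw [← hac]
      refine add_mem ?_ (Submodule.subset_span ⟨1, c, fun w _ => map_one _, fun e => ?_,
        (one_mul c).symm⟩)
      -- The multiplier `q` is quantified so that the span induction passes through multiplication
      -- by arbitrary polynomials. For a generator of degree j > 0, the component of degree d of the
      -- product is that generator times a form of degree d - j, which the induction on the degree
      -- covers.
      · have hI : ∀ x ∈ invariantIdeal b G, ∀ q, homogeneousComponent d (q * x) ∈ M := by
          intro x hx
          induction hx using Submodule.span_induction with
          | mem g hg =>
            obtain ⟨j, hj, hgj, hgi⟩ := hg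
            intro q
            rcases lt_or_ge d j with hdj | hdj
            · rw [homogeneousComponent_mul_of_lt hgj hdj]
              exact zero_mem _
            · obtain ⟨k, rfl⟩ := Nat.exists_eq_add_of_le' hdj
              rw [homogeneousComponent_add_mul hgj]
              exact hmul g hgi _ (ih k (by omega) _ (homogeneousComponent_isHomogeneous k q))
          | zero => intro q; rw [mul_zero, map_zero]; exact zero_mem _
          | add x y _ _ h1 h2 => intro q; rw [mul_add, map_add]; exact add_mem (h1 q) (h2 q)
          | smul c x _ h1 => intro q; rw [smul_eq_mul, ← mul_assoc]; exact h1 _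
        have h1 := hI a ha.1 1
        rwa [one_mul, homogeneousComponent_of_mem ha.2, if_pos rfl] at h1
      · rw [homogeneousComponent_of_mem hcd]
        split_ifs with h
        · exact h ▸ hc
        · exact zero_mem _
  rw [eq_top_iff]
  intro f _
  rw [← sum_homogeneousComponent f]
  exact sum_mem fun i _ => key i _ (homogeneousComponent_isHomogeneous i f)

/-- A finite reflection group over a field of characteristic zero acts freely on the orbit of a
vector which is not fixed by a conjugate of one of the generating reflections. -/
theorem eq_one_of_apply_eq [CharZero K] [FiniteDimensional K V] (G : Subgroup (V ≃ₗ[K] V))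
    [Finite G] {T : Set (V ≃ₗ[K] V)} (hT : Subgroup.closure T = G)
    (hrefl : ∀ s ∈ T, ∃ (l : Module.Dual K V) (a : V), ∀ v, s v = v - l v • a) {v : V}
    (hv : ∀ s ∈ T, ∀ w ∈ G, s (w v) ≠ w v) {w : V ≃ₗ[K] V} (hw : w ∈ G) (hwv : w v = v) :
    w = 1 := by
  classical
  have := Fintype.ofFinite G
  let b := Module.finBasis K V
  choose H hH using fun d => Submodule.exists_isCompl
    ((invariantIdeal b G).restrictScalars K ⊓ homogeneousSubmodule (Fin (Module.finrank K V)) K d)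
  -- The direct sum of the graded complements `H d`, as a space of polynomials.
  let N : Submodule K (MvPolynomial (Fin (Module.finrank K V)) K) :=
    ⨅ d, (H d).comap (homogeneousComponent d)
  have hN : ∀ {f}, f ∈ N ↔ ∀ d, homogeneousComponent d f ∈ H d := by
    intro f
    simp [N]
  have hinj : Function.Injective (evalOrbit b G v ∘ₗ N.subtype) := by
    rw [← LinearMap.ker_eq_bot, LinearMap.ker_eq_bot']
    rintro ⟨f, hf⟩ h0
    have h1 : ∀ u ∈ G, eval (b.equivFun (u v)) f = 0 := fun u hu => by
      have h2 := congrFun h0 ⟨u, hu⟩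
      rwa [LinearMap.comp_apply, evalOrbit_apply] at h2
    -- The component in degree `f.totalDegree` lies both in the ideal and in its complement, so it
    -- is zero; for nonzero `f` this contradicts the existence of a monomial of top degree.
    have h2 := homogeneousComponent_mem_invariantIdeal b G hT hrefl hv f.totalDegree f le_rfl h1
    have h3 := (Submodule.disjoint_def.1 (hH f.totalDegree).disjoint) _
      ⟨h2, homogeneousComponent_isHomogeneous _ f⟩ (hN.1 hf _)
    apply Subtype.ext
    by_contra hf0
    obtain ⟨m, hm, hmd⟩ := Finset.exists_mem_eq_sup f.support (support_nonempty.2 hf0)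
      fun m => m.sum fun _ e => e
    have hmd : f.totalDegree = m.degree := hmd
    have h4 := congrArg (coeff m) h3
    rw [coeff_homogeneousComponent, if_pos hmd.symm, coeff_zero] at h4
    exact mem_support_iff.1 hm h4
  obtain ⟨v₀, hv₀⟩ := exists_forall_apply_ne G
  -- Along the orbit of `v₀` an invariant is constant, so a product of an invariant and an element
  -- of `N` has the same values as a scalar multiple of the latter.
  have hsurj : Function.Surjective (evalOrbit b G v₀ ∘ₗ N.subtype) := by
    rw [← LinearMap.range_eq_top, LinearMap.range_comp, Submodule.range_subtype, eq_top_iff,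
      ← LinearMap.range_eq_top.2 (evalOrbit_surjective b G hv₀), LinearMap.range_eq_map,
      ← span_invariant_mul_eq_top b G hH, Submodule.map_span_le]
    rintro _ ⟨g, h, hg, hh, rfl⟩
    have h1 : evalOrbit b G v₀ (g * h) = eval (b.equivFun v₀) g • evalOrbit b G v₀ h := by
      ext u
      rw [Pi.smul_apply, evalOrbit_apply, evalOrbit_apply, map_mul, ← eval_linSubst, hg u.1 u.2,
        smul_eq_mul]
    rw [h1]
    exact Submodule.smul_mem _ _ (Submodule.mem_map_of_mem (hN.2 hh))
  have : FiniteDimensional K N := FiniteDimensional.of_injective _ hinj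
  have hdim : Module.finrank K N = Module.finrank K (G → K) :=
    le_antisymm (LinearMap.finrank_le_finrank_of_injective hinj)
      (LinearMap.finrank_le_finrank_of_surjective hsurj)
  -- Injectivity at `v` and equality of dimensions yield a polynomial that is 1 at `v` and 0 at `u
  -- v` for every u ≠ 1 in the group.
  obtain ⟨f, hf⟩ := (LinearMap.injective_iff_surjective_of_finrank_eq_finrank hdim).1 hinj
    (Pi.single 1 1)
  have h1 := congrFun hf 1
  have h2 := congrFun hf ⟨w, hw⟩
  rw [LinearMap.comp_apply, evalOrbit_apply, Pi.single_eq_same] at h1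
  rw [LinearMap.comp_apply, evalOrbit_apply] at h2
  by_contra hw1
  rw [Pi.single_eq_of_ne (fun h => hw1 (congrArg Subtype.val h))] at h2
  have h3 : (1 : G).1 v = w v := hwv.symm
  rw [h3, h2] at h1
  exact zero_ne_one h1

end PolynomialInvariants

/-! ### Fixed vectors and negated roots -/

section ReflectionExtension

variable {V : Type*} [AddCommGroup V] [Module ℚ_[2] V]

/-- The coefficient function of `IsLinearReflection.exists_form` is automatically linear, because
the vector it multiplies is nonzero. -/
theorem IsLinearReflection.exists_dual {σ : V ≃ₗ[ℚ_[2]] V} (hσ : IsLinearReflection σ) :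
    ∃ (l : Module.Dual ℚ_[2] V) (a : V), ∀ v, σ v = v - l v • a := by
  obtain ⟨a, f, ha, h, -⟩ := hσ.exists_form
  have hf : ∀ v, f v • a = v - σ v := fun v => by rw [h]; abel
  refine ⟨⟨⟨f, fun x y => ?_⟩, fun c x => ?_⟩, a, h⟩
  · apply smul_left_injective _ ha
    change f (x + y) • a = (f x + f y) • a
    rw [add_smul, hf, hf, hf, map_add]
    abel
  · apply smul_left_injective _ ha
    change f (c • x) • a = (c * f x) • a
    rw [mul_smul, hf, hf, map_smul, smul_sub]

/-- A nontrivial element of a finite reflection group fixes no more vectors than some reflection. -/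
theorem exists_reflection_fixing [FiniteDimensional ℚ_[2] V] {W : Subgroup (V ≃ₗ[ℚ_[2]] V)}
    [Finite W] (hW : IsReflectionGroup W) {w : W} (hw : w ≠ 1) :
    ∃ τ : Reflections W, ∀ v, w.1 v = v → τ.1.1 v = v := by
  by_contra! hcon
  let F : Subspace ℚ_[2] V := LinearMap.eqLocus w.1.toLinearMap LinearMap.id
  let p : Reflections W → Subspace ℚ_[2] F := fun τ =>
    (LinearMap.eqLocus τ.1.1.toLinearMap LinearMap.id).comap F.subtype
  -- If no reflection fixed all of `F`, the reflections would cut out finitely many proper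
  -- subspaces, which cannot cover `F`. So some vector fixed by `w` is fixed by no reflection.
  obtain ⟨⟨v, hv⟩, hvτ⟩ : ∃ v : F, ∀ τ, v ∉ p τ := by
    by_contra! hc
    obtain ⟨τ, hτ⟩ := Subspace.exists_eq_top_of_iUnion_eq_univ
      (Set.eq_univ_of_forall fun v => Set.mem_iUnion.2 (hc v))
    obtain ⟨v, hv, hvτ⟩ := hcon τ
    have : (⟨v, hv⟩ : F) ∈ p τ := hτ ▸ Submodule.mem_top
    exact hvτ this
  refine hw (Subtype.ext (eq_one_of_apply_eq W hW (fun s hs => hs.2.exists_dual) (v := v) ?_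
    w.2 hv))
  rintro s ⟨hs, hsr⟩ u hu h
  -- If `s` fixed `u v`, the conjugate reflection u⁻¹su would fix `v`.
  refine hvτ ((⟨u, hu⟩⁻¹ : W) • ⟨⟨s, hs⟩, hsr⟩) ?_
  change (((⟨u, hu⟩⁻¹ : W) • (⟨⟨s, hs⟩, hsr⟩ : Reflections W)).1.1) v = v
  rw [Reflections.smul_val]
  change u.symm (s ((u⁻¹⁻¹ : V ≃ₗ[ℚ_[2]] V) v)) = v
  rw [inv_inv, h]
  exact u.symm_apply_apply v

theorem Reflections.commute_iff {W : Subgroup (V ≃ₗ[ℚ_[2]] V)} (σ : Reflections W) (w : W) :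
    w * σ.1 = σ.1 * w ↔ w • σ = σ := by
  rw [← mul_inv_eq_iff_eq_mul, ← Reflections.smul_val]
  exact Subtype.ext_iff.symm

/-- Elements of `W` mapping `a` to `-a` commute with `τ`. -/
theorem Reflections.commute_of_map_neg {W : Subgroup (V ≃ₗ[ℚ_[2]] V)} [Finite W]
    {τ : Reflections W} {a : V} (ha : a ≠ 0) (hτa : τ.1.1 a = -a) {w : W} (hw : w.1 a = -a) :
    w * τ.1 = τ.1 * w := by
  have h1 : (τ.1 * w).1 a = a := by
    change τ.1.1 (w.1 a) = a
    rw [hw, map_neg, hτa, neg_neg]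
  have h2 := τ.commute_of_map ha hτa h1
  rw [mul_assoc] at h2
  exact mul_left_cancel h2

/-- Reflections in a finite group that negate the same nonzero vector are equal. -/
theorem Reflections.eq_of_map_neg {W : Subgroup (V ≃ₗ[ℚ_[2]] V)} [Finite W]
    {σ τ : Reflections W} {a : V} (ha : a ≠ 0) (hσa : σ.1.1 a = -a) (hτa : τ.1.1 a = -a) :
    σ = τ := by
  obtain ⟨f, hf⟩ := σ.form ha hσa
  obtain ⟨g, hg⟩ := τ.form ha hτa
  have h1 : ∀ v, (σ.1 * τ.1).1 v = v - (g v + f (τ.1.1 v)) • a := by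
    intro v
    change σ.1.1 (τ.1.1 v) = _
    rw [hf (τ.1.1 v), add_smul, ← sub_sub, ← hg v]
  have h2 : (σ.1 * τ.1).1 a = a := by
    change σ.1.1 (τ.1.1 a) = a
    rw [hτa, map_neg, hσa, neg_neg]
  obtain ⟨m, hm, hm1⟩ := exists_pow_eq_one_val (σ.1 * τ.1)
  have h3 : σ.1 * τ.1 = 1 :=
    Subtype.ext (LinearEquiv.ext (transvection_finite_order h1 h2 hm hm1))
  exact Subtype.ext (mul_right_cancel (h3.trans τ.mul_self.symm))

/-- For an involution `w` in a finite reflection group there is a reflection whose root is negated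
by `w`. -/
theorem exists_reflection_neg [FiniteDimensional ℚ_[2] V] {W : Subgroup (V ≃ₗ[ℚ_[2]] V)}
    [Finite W] (hW : IsReflectionGroup W) {w : W} (hw : w ≠ 1) (hw2 : w * w = 1) :
    ∃ τ : Reflections W, (∀ v, w.1 v = v → τ.1.1 v = v) ∧
      ∀ a : V, τ.1.1 a = -a → w.1 a = -a := by
  obtain ⟨τ, hτ⟩ := exists_reflection_fixing hW hw
  refine ⟨τ, hτ, fun a hτa => ?_⟩
  by_cases ha : a = 0
  · simp [ha]
  obtain ⟨f, hf⟩ := τ.form ha hτa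
  have hww : ∀ v, w.1 (w.1 v) = v := fun v => by
    change (w * w).1 v = v
    rw [hw2]; rfl
  -- The aim is to show that this `w`-fixed vector, hence also `τ`-fixed, is zero.
  have hz : w.1 (a + w.1 a) = a + w.1 a := by rw [map_add, hww, add_comm]
  have hz' := hτ _ hz
  -- As `τ` fixes every v + wv, the product wτwτ is a transvection along a + wa, which it fixes.
  -- Having finite order it is trivial, and at `a`, where `f a` is nonzero, this gives a + wa = 0.
  have hu : ∀ v, (w * τ.1 * w * τ.1).1 v = v - f v • (a + w.1 a) := by
    intro v
    have h1 : τ.1.1 (v + w.1 v) = v + w.1 v := hτ _ (by rw [map_add, hww, add_comm])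
    have h2 : τ.1.1 (w.1 v) = w.1 v + f v • a := by
      rw [map_add, hf v] at h1
      have h3 : τ.1.1 (w.1 v) = (v - f v • a + τ.1.1 (w.1 v)) - v + f v • a := by abel
      rw [h3, h1]; abel
    have h4 : τ.1.1 (w.1 a) = w.1 a + (2 : ℚ_[2]) • a := by
      rw [map_add, hτa] at hz'
      have h3 : τ.1.1 (w.1 a) = (-a + τ.1.1 (w.1 a)) + a := by abel
      rw [h3, hz', two_smul]; abel
    change w.1 (τ.1.1 (w.1 (τ.1.1 v))) = _
    rw [hf v, map_sub, map_smul, map_sub, map_smul, h2, h4, map_sub, map_add, map_smul, map_smul,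
      map_add, map_smul, hww, hww, two_smul, smul_add, smul_add, smul_add]
    abel
  have huz : (w * τ.1 * w * τ.1).1 (a + w.1 a) = a + w.1 a := by
    change w.1 (τ.1.1 (w.1 (τ.1.1 (a + w.1 a)))) = _
    rw [hz', hz, hz', hz]
  obtain ⟨m, hm, hm1⟩ := exists_pow_eq_one_val (w * τ.1 * w * τ.1)
  have h1 := transvection_finite_order hu huz hm hm1 a
  rw [hu a] at h1
  have h2 : f a • (a + w.1 a) = 0 := by
    rw [← sub_eq_self (a := a)]; exact h1
  rcases smul_eq_zero.1 h2 with h3 | h3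
  · have h4 := hf a
    rw [hτa, h3, zero_smul, sub_zero] at h4
    exact absurd h4.symm (ne_neg_self ha)
  · exact (neg_eq_of_add_eq_zero_right h3).symm

/-! ### The degree attached to a reflection -/

/-- The restriction to the centralizer of `σ` of a reflection extension: an additive function on the
preimage of this centralizer which doubles the coefficient of `σ` on the kernel, and whose parity
gives the action on a root of `σ`. -/
theorem IsReflectionExtension.exists_degree {W : Subgroup (V ≃ₗ[ℚ_[2]] V)} [Finite W]
    {R : Type*} [Group R] {S : GroupExtension (Multiplicative (ReflModule W)) R W}
    (hS : IsReflectionExtension S) (σ : Reflections W) :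
    ∃ (ψ : R → ℤ) (a : V), a ≠ 0 ∧ σ.1.1 a = -a ∧
      (∀ x y, S.rightHom x • σ = σ → S.rightHom y • σ = σ → ψ (x * y) = ψ x + ψ y) ∧
      (∀ u : ReflModule W, ψ (S.inl (Multiplicative.ofAdd u)) = 2 * u σ) ∧
      ∀ x, S.rightHom x • σ = σ → (Even (ψ x) → (S.rightHom x).1 a = a) ∧
        (Odd (ψ x) → (S.rightHom x).1 a = -a) := by
  classical
  obtain ⟨τ, hconj, a, ha, hτa, φ, hφ, hφr⟩ := hS.shapiro σ
  obtain ⟨w, hw⟩ := isConj_iff.1 hconj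
  have hwσ : w • σ = τ := Subtype.ext hw
  obtain ⟨g, rfl⟩ := S.rightHom_surjective w
  have hmem : ∀ x, S.rightHom x • σ = σ →
      g * x * g⁻¹ ∈ (Subgroup.centralizer {τ.1}).comap S.rightHom := by
    intro x hx
    rw [Subgroup.mem_comap, Subgroup.mem_centralizer_singleton_iff, Reflections.commute_iff,
      map_mul, map_mul, map_inv, mul_smul, mul_smul, ← hwσ, inv_smul_smul, hx]
  have hone : ∀ u, S.rightHom (S.inl u) • σ = σ := fun u => by rw [S.rightHom_inl, one_smul]
  -- Conjugation by a lift `g` of an element carrying `σ` to the chosen representative `τ` moves `x`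
  -- into the domain of `φ`; the degree is the ℤ-component of the result. Elements not centralizing
  -- `σ` get the irrelevant value 0, and the root of `σ` is g⁻¹a.
  refine ⟨fun x => if hx : S.rightHom x • σ = σ then (φ ⟨_, hmem x hx⟩).1.toAdd else 0,
    (S.rightHom g).1.symm a, by simpa using ha, ?_, ?_, ?_, ?_⟩
  · have h1 : σ.1 = (S.rightHom g)⁻¹ * τ.1 * S.rightHom g := by rw [← hw]; group
    rw [h1]
    change (S.rightHom g).1.symm (τ.1.1 ((S.rightHom g).1 ((S.rightHom g).1.symm a))) = _
    rw [LinearEquiv.apply_symm_apply, hτa, map_neg]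
  · intro x y hx hy
    have hxy : S.rightHom (x * y) • σ = σ := by rw [map_mul, mul_smul, hy, hx]
    dsimp only
    rw [dif_pos hx, dif_pos hy, dif_pos hxy, ← toAdd_mul, ← Prod.fst_mul, ← map_mul]
    congr 3
    apply Subtype.ext
    change g * (x * y) * g⁻¹ = g * x * g⁻¹ * (g * y * g⁻¹)
    group
  · intro u
    dsimp only
    rw [dif_pos (hone _)]
    have h1 := hS.conj_inl g u
    have h2 : S.inl (Multiplicative.ofAdd (reflAct (S.rightHom g) u)) ∈
        (Subgroup.centralizer {τ.1}).comap S.rightHom := by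
      rw [← h1]; exact hmem _ (hone _)
    have h3 := hφ _ h2
    have h4 : (⟨_, hmem _ (hone (Multiplicative.ofAdd u))⟩ :
        (Subgroup.centralizer {τ.1}).comap S.rightHom) = ⟨_, h2⟩ := Subtype.ext h1
    rw [h4, h3]
    change 2 • (reflAct (S.rightHom g) u τ) = _
    rw [reflAct_apply, ← hwσ, inv_smul_smul, two_smul, two_mul]
  · intro x hx
    dsimp only
    rw [dif_pos hx]
    have h1 := hφr ⟨_, hmem x hx⟩
    set y := φ ⟨_, hmem x hx⟩ with hy
    have h2 : τ.1 ^ y.1.toAdd * y.2.1 = S.rightHom g * S.rightHom x * (S.rightHom g)⁻¹ := by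
      rw [← map_inv, ← map_mul, ← map_mul, ← h1]
      rfl
    have h3 : y.2.1.1 a = a := y.2.2
    have h4 : (S.rightHom x).1 ((S.rightHom g).1.symm a) =
        (S.rightHom g).1.symm ((τ.1 ^ y.1.toAdd).1 a) := by
      rw [← LinearEquiv.symm_apply_eq, LinearEquiv.symm_symm]
      have h5 := congrArg (fun z : W => z.1 a) h2
      change (τ.1 ^ y.1.toAdd).1 (y.2.1.1 a) =
        (S.rightHom g).1 ((S.rightHom x).1 ((S.rightHom g).1.symm a)) at h5
      rw [← h5, h3]
    refine ⟨fun h => ?_, fun h => ?_⟩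
    · rw [h4, (τ.zpow_apply hτa _).1 h]
    · rw [h4, (τ.zpow_apply hτa _).2 h, map_neg]

end ReflectionExtension

/-! ### The permutation module under a reflection -/

section ReflectionExtension

variable {V : Type*} [AddCommGroup V] [Module ℚ_[2] V] {W : Subgroup (V ≃ₗ[ℚ_[2]] V)}

theorem reflAct_mul (w w' : W) (u : ReflModule W) :
    reflAct (w * w') u = reflAct w (reflAct w' u) := by
  ext s
  rw [reflAct_apply, reflAct_apply, reflAct_apply, mul_inv_rev, mul_smul]

theorem reflAct_one (u : ReflModule W) : reflAct 1 u = u := by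
  ext s
  rw [reflAct_apply, inv_one, one_smul]

theorem reflAct_single (w : W) (σ : Reflections W) (n : ℤ) :
    reflAct w (Finsupp.single σ n) = Finsupp.single (w • σ) n :=
  Finsupp.mapDomain_single

theorem Reflections.smul_self (σ : Reflections W) : σ.1 • σ = σ :=
  (σ.commute_iff σ.1).1 rfl

theorem Reflections.inv_eq [Finite W] (σ : Reflections W) : σ.1⁻¹ = σ.1 :=
  inv_eq_of_mul_eq_one_right σ.mul_self

theorem reflAct_reflAct [Finite W] (σ : Reflections W) (u : ReflModule W) :
    reflAct σ.1 (reflAct σ.1 u) = u := by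
  rw [← reflAct_mul, σ.mul_self, reflAct_one]

/-- The vanishing of the Tate cohomology of the free part of `ℤ[Σ]` under a reflection. -/
theorem exists_add_smul_reflAct_eq [Finite W] (σ : Reflections W) {ε : ℤ} (hε : ε * ε = 1)
    {u : ReflModule W} (hu : reflAct σ.1 u = ε • u)
    (hfix : ∀ τ : Reflections W, σ.1 • τ = τ → ∃ k, u τ = k + ε * k) :
    ∃ n : ReflModule W, n + ε • reflAct σ.1 n = u := by
  classical
  choose! k hk using hfix
  obtain ⟨N, ⟨e⟩⟩ := Finite.exists_equiv_fin (Reflections W)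
  -- In each two-element orbit of `σ` the solution carries the whole coefficient on the smaller
  -- element, for an arbitrary ordering of the reflections; at fixed points it is the given `k`.
  refine ⟨Finsupp.equivFunOnFinite.symm fun τ =>
    if σ.1 • τ = τ then k τ else if e τ < e (σ.1 • τ) then u τ else 0, ?_⟩
  ext τ
  have hστ : σ.1 • σ.1 • τ = τ := by rw [← mul_smul, σ.mul_self, one_smul]
  have huτ : u (σ.1 • τ) = ε * u τ := by
    have h := DFunLike.congr_fun hu τ
    rwa [reflAct_apply, σ.inv_eq] at h
  rw [Finsupp.add_apply, Finsupp.smul_apply, reflAct_apply, σ.inv_eq, smul_eq_mul]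
  simp only [Finsupp.equivFunOnFinite_symm_apply_apply, hστ]
  by_cases h : σ.1 • τ = τ
  · rw [if_pos h, if_pos h.symm, h, hk τ h]
  · rw [if_neg h, if_neg (Ne.symm h)]
    have hne : e τ ≠ e (σ.1 • τ) := fun h' => h (e.injective h').symm
    rcases lt_or_gt_of_ne hne with h' | h'
    · rw [if_pos h', if_neg h'.not_gt, mul_zero, add_zero]
    · rw [if_neg h'.not_gt, if_pos h', huτ, ← mul_assoc, hε, one_mul, zero_add]

theorem reflC_eq_ker [Finite W] (σ : Reflections W) :
    reflC σ = (AddMonoidHom.id (ReflModule W) + reflAct σ.1).ker := by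
  ext u
  rw [AddMonoidHom.mem_ker]
  constructor
  · rintro ⟨n, rfl⟩
    simp only [AddMonoidHom.add_apply, AddMonoidHom.sub_apply, AddMonoidHom.id_apply, map_sub,
      reflAct_reflAct]
    abel
  · intro h
    have h1 : reflAct σ.1 u = (-1 : ℤ) • u := by
      rw [neg_one_smul]
      exact (neg_eq_of_add_eq_zero_right h).symm
    -- With sign -1 the condition at a fixed `τ` is u(τ) = 0, and it holds since u(τ) = -u(τ).
    obtain ⟨n, hn⟩ := exists_add_smul_reflAct_eq σ (ε := -1) (by norm_num) h1 fun τ hτ => by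
      refine ⟨0, ?_⟩
      have h2 := DFunLike.congr_fun h1 τ
      rw [reflAct_apply, inv_smul_eq_iff.2 hτ.symm, Finsupp.smul_apply, smul_eq_mul] at h2
      omega
    refine ⟨n, ?_⟩
    rw [← hn, neg_one_smul, ← sub_eq_add_neg]
    rfl

theorem mem_reflC_iff [Finite W] (σ : Reflections W) (u : ReflModule W) :
    u ∈ reflC σ ↔ u + reflAct σ.1 u = 0 := by
  rw [reflC_eq_ker, AddMonoidHom.mem_ker]
  rfl

theorem reflAct_mem_reflC [Finite W] (w : W) {σ : Reflections W} {u : ReflModule W}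
    (hu : u ∈ reflC σ) : reflAct w u ∈ reflC (w • σ) := by
  rw [mem_reflC_iff] at hu ⊢
  rw [Reflections.smul_val, ← reflAct_mul, inv_mul_cancel_right, reflAct_mul, ← map_add, hu,
    map_zero]

/-! ### Conjugation and squares in the extension -/

variable {R : Type*} [Group R] {S : GroupExtension (Multiplicative (ReflModule W)) R W}

theorem mem_kerSubgroup_iff {C : AddSubgroup (ReflModule W)} {y : R} :
    y ∈ kerSubgroup S C ↔ ∃ u ∈ C, S.inl (Multiplicative.ofAdd u) = y :=
  Iff.rfl

theorem inl_mem_kerSubgroup_iff {C : AddSubgroup (ReflModule W)} {u : ReflModule W} :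
    S.inl (Multiplicative.ofAdd u) ∈ kerSubgroup S C ↔ u ∈ C :=
  Subgroup.mem_map_iff_mem S.inl_injective

theorem GroupExtension.exists_inl_eq {x : R} (hx : S.rightHom x = 1) :
    ∃ u : ReflModule W, S.inl (Multiplicative.ofAdd u) = x := by
  rw [← MonoidHom.mem_ker, ← S.range_inl_eq_ker_rightHom] at hx
  exact hx

/-- A family of subsets permuted by conjugation. -/
theorem image_conj_eq {A : Reflections W → Set R}
    (hA : ∀ σ x, ∀ y ∈ A σ, x * y * x⁻¹ ∈ A (S.rightHom x • σ)) (σ : Reflections W) (x : R) :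
    (fun y => x * y * x⁻¹) '' A σ = A (S.rightHom x • σ) := by
  refine Set.Subset.antisymm ?_ fun y hy => ⟨x⁻¹ * y * x, ?_, by group⟩
  · rintro _ ⟨y, hy, rfl⟩
    exact hA σ x y hy
  · have h := hA _ x⁻¹ y hy
    rwa [map_inv, inv_smul_smul, inv_inv] at h

variable [Finite W]

theorem IsReflectionExtension.mul_inl (hS : IsReflectionExtension S) (x : R) (u : ReflModule W) :
    x * S.inl (Multiplicative.ofAdd u) =
      S.inl (Multiplicative.ofAdd (reflAct (S.rightHom x) u)) * x := by
  rw [← hS.conj_inl, inv_mul_cancel_right]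

/-- Changing a lift of w by n changes its square by the norm n + wn. Finding square roots of `σ` is
thereby a norm equation, and two of them over `σ` differ by an element of ker(1 + σ). -/
theorem IsReflectionExtension.mul_inl_sq (hS : IsReflectionExtension S) {x : R}
    {q : ReflModule W} (hx : x ^ 2 = S.inl (Multiplicative.ofAdd q)) (n : ReflModule W) :
    (x * S.inl (Multiplicative.ofAdd n)) ^ 2 =
      S.inl (Multiplicative.ofAdd (q + (n + reflAct (S.rightHom x) n))) := by
  calc (x * S.inl (Multiplicative.ofAdd n)) ^ 2
      = (x * S.inl (Multiplicative.ofAdd n)) * (x * S.inl (Multiplicative.ofAdd n)) := pow_two _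
    _ = S.inl (Multiplicative.ofAdd (reflAct (S.rightHom x) n)) * x ^ 2 *
          S.inl (Multiplicative.ofAdd n) := by
        nth_rewrite 1 [hS.mul_inl]
        simp only [pow_two, mul_assoc]
    _ = _ := by
        rw [hx, ← map_mul, ← map_mul, ← ofAdd_add, ← ofAdd_add]
        congr 2
        abel

theorem IsReflectionExtension.conj_mem_kerSubgroup (hS : IsReflectionExtension S)
    {σ : Reflections W} (x : R) {y : R} (hy : y ∈ kerSubgroup S (reflC σ)) :
    x * y * x⁻¹ ∈ kerSubgroup S (reflC (S.rightHom x • σ)) := by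
  obtain ⟨u, hu, rfl⟩ := mem_kerSubgroup_iff.1 hy
  rw [hS.conj_inl, inl_mem_kerSubgroup_iff]
  exact reflAct_mem_reflC _ hu

theorem IsReflectionExtension.conj_mem_reflQ (hS : IsReflectionExtension S)
    {σ : Reflections W} (x : R) {y : R} (hy : y ∈ reflQ S σ) :
    x * y * x⁻¹ ∈ reflQ S (S.rightHom x • σ) := by
  change (x * y * x⁻¹) ^ 2 = _
  rw [conj_pow, show y ^ 2 = _ from hy, hS.conj_inl, reflAct_single]

/-- An element commutes with its own square, so its image fixes the basis vector `σ`. -/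
theorem IsReflectionExtension.smul_eq_of_sq_eq_single (hS : IsReflectionExtension S)
    {σ : Reflections W} {x : R} (hx : x ∈ reflQ S σ) : S.rightHom x • σ = σ := by
  have h := hS.conj_mem_reflQ x hx
  rw [mul_inv_cancel_right] at h
  have h1 := S.inl_injective ((show x ^ 2 = _ from hx).symm.trans h)
  exact (Finsupp.single_left_injective one_ne_zero (Multiplicative.ofAdd.injective h1)).symm

/-! ### Involutions, and the square roots of a reflection as a coset -/

variable [FiniteDimensional ℚ_[2] V]

/-- The kernel is torsion-free, so an involution has nontrivial image, which negates the root of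
some `τ`. Its degree at `τ` is then odd, but twice it is the degree 0 of the identity. -/
theorem IsReflectionExtension.orderOf_ne_two (hS : IsReflectionExtension S)
    (hW : IsReflectionGroup W) (x : R) : orderOf x ≠ 2 := by
  intro hx
  obtain ⟨hx2, hx1⟩ := (orderOf_eq_prime_iff (p := 2)).1 hx
  have hw2 : S.rightHom x * S.rightHom x = 1 := by
    rw [← map_mul, ← pow_two, hx2, map_one]
  have hone : (1 : R) = S.inl (Multiplicative.ofAdd 0) := by rw [ofAdd_zero, map_one]
  by_cases hw : S.rightHom x = 1
  · obtain ⟨u, rfl⟩ := S.exists_inl_eq hw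
    rw [hone, ← map_pow, ← ofAdd_nsmul] at hx2
    have h1 := Multiplicative.ofAdd.injective (S.inl_injective hx2)
    have h2 : u = 0 := by simpa using h1
    exact hx1 (by rw [h2, hone])
  · obtain ⟨τ, -, hτ⟩ := exists_reflection_neg hW hw hw2
    obtain ⟨ψ, a, ha, hτa, hadd, hinl, hpar⟩ := hS.exists_degree τ
    have hwa := hτ a hτa
    have hfix : S.rightHom x • τ = τ := (τ.commute_iff _).1 (τ.commute_of_map_neg ha hτa hwa)
    have h1 := hadd x x hfix hfix
    rw [← pow_two, hx2, hone, hinl, Finsupp.zero_apply] at h1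
    have h2 : ψ x = 0 := by omega
    have h3 := (hpar x hfix).1 (by rw [h2]; exact Even.zero)
    exact ne_neg_self ha (h3.symm.trans hwa)

/-- The degree of `x` at `σ` is 1, so w = π(x) negates the root of `σ`. If w ≠ σ, the involution wσ
negates the root of some `τ` ≠ `σ`, and so does w; then `x` has odd degree at `τ`, although x² = σ
has coefficient 0 there. -/
theorem IsReflectionExtension.rightHom_eq (hS : IsReflectionExtension S)
    (hW : IsReflectionGroup W) {σ : Reflections W} {x : R} (hx : x ∈ reflQ S σ) :
    S.rightHom x = σ.1 := by
  have hxσ := hS.smul_eq_of_sq_eq_single hx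
  have hx2 : x * x = S.inl (Multiplicative.ofAdd (Finsupp.single σ 1)) := by
    rw [← pow_two]; exact hx
  set w := S.rightHom x with hw
  have hw2 : w * w = 1 := by rw [hw, ← map_mul, hx2, S.rightHom_inl]
  have hwσ : w * σ.1 = σ.1 * w := (σ.commute_iff w).2 hxσ
  obtain ⟨ψ, a, ha, hσa, hadd, hinl, hpar⟩ := hS.exists_degree σ
  have hψ : ψ x = 1 := by
    have h1 := hadd x x hxσ hxσ
    rw [hx2, hinl, Finsupp.single_eq_same] at h1
    omega
  have hwa : w.1 a = -a := (hpar x hxσ).2 (by rw [hψ]; exact odd_one)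
  by_contra hne
  have hwσ1 : w * σ.1 ≠ 1 := fun h => hne (by rw [eq_inv_of_mul_eq_one_left h, σ.inv_eq])
  have hwσ2 : w * σ.1 * (w * σ.1) = 1 := by
    calc w * σ.1 * (w * σ.1) = w * (σ.1 * w) * σ.1 := by simp only [mul_assoc]
      _ = w * w * (σ.1 * σ.1) := by rw [← hwσ]; simp only [mul_assoc]
      _ = 1 := by rw [hw2, σ.mul_self, one_mul]
  obtain ⟨τ, hτ, hτneg⟩ := exists_reflection_neg hW hwσ1 hwσ2
  obtain ⟨ψ', b, hb, hτb, hadd', hinl', hpar'⟩ := hS.exists_degree τ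
  have hwσa : (w * σ.1).1 a = a := by
    change w.1 (σ.1.1 a) = a
    rw [hσa, map_neg, hwa, neg_neg]
  have hwσb := hτneg b hτb
  have hne : τ ≠ σ := by
    rintro rfl
    have h1 := hτ a hwσa
    rw [hσa] at h1
    exact ne_neg_self ha h1.symm
  -- `τ` fixes the root `a` of `σ`, because wσ does; so the two reflections commute and `σ` fixes
  -- the root `b` of `τ`.
  have hτσ : τ.1 * σ.1 = σ.1 * τ.1 := σ.commute_of_map ha hσa (hτ a hwσa)
  have hσb : σ.1.1 b = b := by
    rcases τ.map_of_commute hb hτb hτσ.symm with h | h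
    · exact h
    · exact absurd (Reflections.eq_of_map_neg hb hτb h) hne
  have hwb : w.1 b = -b := by
    have h1 : w.1 (σ.1.1 b) = -b := hwσb
    rwa [hσb] at h1
  have hfix : w • τ = τ := (τ.commute_iff w).1 (τ.commute_of_map_neg hb hτb hwb)
  have h1 := hadd' x x hfix hfix
  rw [hx2, hinl', Finsupp.single_eq_of_ne hne] at h1
  have h2 : ψ' x = 0 := by omega
  have h3 := (hpar' x hfix).1 (by rw [h2]; exact Even.zero)
  exact ne_neg_self hb (h3.symm.trans hwb)

-- For a lift x of `σ` with x² = u, the square becomes `σ` after multiplying x by a solution n of n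
-- + σn = σ - u. The right side is invariant, so only its coefficients at reflections τ fixed by `σ`
-- must be even. There u(τ) is the degree of x at τ, which is odd exactly for τ = σ, as `σ` negates
-- no other root.
omit [FiniteDimensional ℚ_[2] V] in
theorem IsReflectionExtension.reflQ_nonempty (hS : IsReflectionExtension S)
    (σ : Reflections W) : (reflQ S σ).Nonempty := by
  obtain ⟨x, hx⟩ := S.rightHom_surjective σ.1
  obtain ⟨u, hu⟩ := S.exists_inl_eq (x := x ^ 2) (by rw [map_pow, hx, pow_two, σ.mul_self])
  have hinv : reflAct σ.1 u = u := by
    have h1 := hS.mul_inl x u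
    rw [hu, ← pow_succ', pow_succ, ← hu, hx] at h1
    exact (Multiplicative.ofAdd.injective (S.inl_injective (mul_right_cancel h1))).symm
  obtain ⟨n, hn⟩ := exists_add_smul_reflAct_eq σ (ε := 1) (one_mul 1)
    (u := Finsupp.single σ 1 - u) (by rw [map_sub, reflAct_single, σ.smul_self, hinv, one_smul])
    fun τ hτ => by
      obtain ⟨ψ, a, ha, hτa, hadd, hinl, hpar⟩ := hS.exists_degree τ
      have hxτ : S.rightHom x • τ = τ := by rw [hx, hτ]
      have h1 := hadd x x hxτ hxτ
      rw [← pow_two, ← hu, hinl] at h1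
      have h2 : u τ = ψ x := by omega
      have h3 := hpar x hxτ
      rw [hx] at h3
      rw [Finsupp.sub_apply, h2]
      by_cases hτσ : τ = σ
      · subst hτσ
        have hodd : Odd (ψ x) := by
          rw [← Int.not_even_iff_odd]
          exact fun h => ne_neg_self ha ((h3.1 h).symm.trans hτa)
        obtain ⟨k, hk⟩ := hodd
        exact ⟨-k, by rw [hk, Finsupp.single_eq_same]; ring⟩
      · have heven : Even (ψ x) := by
          rw [← Int.not_odd_iff_even]
          exact fun h => hτσ (Reflections.eq_of_map_neg ha hτa (h3.2 h))
        obtain ⟨k, hk⟩ := heven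
        exact ⟨-k, by rw [hk, Finsupp.single_eq_of_ne hτσ]; ring⟩
  refine ⟨x * S.inl (Multiplicative.ofAdd n), ?_⟩
  change _ ^ 2 = _
  rw [hS.mul_inl_sq hu.symm, hx]
  rw [one_smul] at hn
  rw [hn, add_sub_cancel]

theorem IsReflectionExtension.mul_mem_reflQ (hS : IsReflectionExtension S)
    (hW : IsReflectionGroup W) {σ : Reflections W} {x c : R} (hx : x ∈ reflQ S σ)
    (hc : c ∈ kerSubgroup S (reflC σ)) : x * c ∈ reflQ S σ := by
  obtain ⟨n, hn, rfl⟩ := mem_kerSubgroup_iff.1 hc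
  change _ ^ 2 = _
  rw [hS.mul_inl_sq hx, hS.rightHom_eq hW hx, (mem_reflC_iff σ n).1 hn, add_zero]

theorem IsReflectionExtension.inv_mul_mem_kerSubgroup (hS : IsReflectionExtension S)
    (hW : IsReflectionGroup W) {σ : Reflections W} {x y : R} (hx : x ∈ reflQ S σ)
    (hy : y ∈ reflQ S σ) : x⁻¹ * y ∈ kerSubgroup S (reflC σ) := by
  obtain ⟨n, hn⟩ := S.exists_inl_eq (x := x⁻¹ * y) (by
    rw [map_mul, map_inv, hS.rightHom_eq hW hx, hS.rightHom_eq hW hy, inv_mul_cancel])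
  have h1 : y = x * S.inl (Multiplicative.ofAdd n) := by rw [hn, mul_inv_cancel_left]
  have h2 := hS.mul_inl_sq hx n
  rw [← h1, show y ^ 2 = _ from hy, hS.rightHom_eq hW hx] at h2
  have h3 := Multiplicative.ofAdd.injective (S.inl_injective h2)
  rw [← hn, inl_mem_kerSubgroup_iff, mem_reflC_iff]
  exact left_eq_add.1 h3

-- Square roots of `σ` normalize C_σ, so its left and right cosets by them agree.
omit [FiniteDimensional ℚ_[2] V] in
theorem IsReflectionExtension.conj_mem_kerSubgroup_iff (hS : IsReflectionExtension S)
    {σ : Reflections W} {x c : R} (hx : x ∈ reflQ S σ) :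
    x * c * x⁻¹ ∈ kerSubgroup S (reflC σ) ↔ c ∈ kerSubgroup S (reflC σ) := by
  have hxσ := hS.smul_eq_of_sq_eq_single hx
  constructor
  · intro h
    have h1 := hS.conj_mem_kerSubgroup x⁻¹ h
    rw [map_inv, inv_smul_eq_iff.2 hxσ.symm] at h1
    convert h1 using 1
    group
  · intro h
    have h1 := hS.conj_mem_kerSubgroup x h
    rwa [hxσ] at h1

theorem IsReflectionExtension.reflQ_eq_coset (hS : IsReflectionExtension S)
    (hW : IsReflectionGroup W) {σ : Reflections W} {x : R} (hx : x ∈ reflQ S σ) :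
    reflQ S σ = (fun c => x * c) '' (kerSubgroup S (reflC σ) : Set R) ∧
      reflQ S σ = (fun c => c * x) '' (kerSubgroup S (reflC σ) : Set R) := by
  constructor <;> ext y
  · constructor
    · exact fun hy => ⟨x⁻¹ * y, hS.inv_mul_mem_kerSubgroup hW hx hy, mul_inv_cancel_left x y⟩
    · rintro ⟨c, hc, rfl⟩
      exact hS.mul_mem_reflQ hW hx hc
  · constructor
    · intro hy
      refine ⟨y * x⁻¹, ?_, inv_mul_cancel_right y x⟩
      have h := (hS.conj_mem_kerSubgroup_iff hx).2 (hS.inv_mul_mem_kerSubgroup hW hx hy)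
      rwa [mul_inv_cancel_left] at h
    · rintro ⟨c, hc, rfl⟩
      have h : x⁻¹ * c * x ∈ kerSubgroup S (reflC σ) := by
        rw [← hS.conj_mem_kerSubgroup_iff hx]
        have h1 : x * (x⁻¹ * c * x) * x⁻¹ = c := by group
        rwa [h1]
      have h1 := hS.mul_mem_reflQ hW hx h
      rwa [← mul_assoc, mul_inv_cancel_left] at h1

/-- The group generated by the square roots of `σ` is the union of two cosets of
`C_σ ⊕ ℤσ`. -/
theorem IsReflectionExtension.mem_closure_reflQ (hS : IsReflectionExtension S)
    (hW : IsReflectionGroup W) {σ : Reflections W} {x : R} (hx : x ∈ reflQ S σ) {y : R}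
    (hy : y ∈ Subgroup.closure (reflQ S σ)) :
    y ∈ kerSubgroup S (reflC σ ⊔ AddSubgroup.zmultiples (Finsupp.single σ 1)) ∨
      ∃ k ∈ kerSubgroup S (reflC σ ⊔ AddSubgroup.zmultiples (Finsupp.single σ 1)), y = x * k := by
  set D := reflC σ ⊔ AddSubgroup.zmultiples (Finsupp.single σ (1 : ℤ)) with hD
  have hmono : ∀ {c}, c ∈ kerSubgroup S (reflC σ) → c ∈ kerSubgroup S D := by
    rintro _ ⟨u, hu, rfl⟩
    exact ⟨u, (le_sup_left : reflC σ ≤ D) hu, rfl⟩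
  have hsq : ∀ {z}, z ∈ reflQ S σ → z * z ∈ kerSubgroup S D := by
    intro z hz
    rw [← pow_two, show z ^ 2 = _ from hz, inl_mem_kerSubgroup_iff]
    exact (le_sup_right : AddSubgroup.zmultiples _ ≤ D) (AddSubgroup.mem_zmultiples _)
  have hDact : ∀ u ∈ D, reflAct σ.1 u ∈ D := by
    intro u hu
    obtain ⟨c, hc, z, ⟨m, rfl⟩, rfl⟩ := AddSubgroup.mem_sup.1 hu
    rw [map_add]
    refine add_mem ((le_sup_left : reflC σ ≤ D) ?_)
      ((le_sup_right : AddSubgroup.zmultiples _ ≤ D) ⟨m, ?_⟩)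
    · have h := reflAct_mem_reflC σ.1 hc
      rwa [σ.smul_self] at h
    · simp only [map_zsmul, reflAct_single, σ.smul_self]
  -- From here on, the union of D and xD is shown to be stable under left multiplication by Q_σ and
  -- its inverses: `x` normalizes D, x² lies in D, and Q_σ lies in xD.
  have hswap : ∀ {k}, k ∈ kerSubgroup S D → ∃ k' ∈ kerSubgroup S D, k * x = x * k' := by
    intro k hk
    obtain ⟨u, hu, rfl⟩ := mem_kerSubgroup_iff.1 hk
    refine ⟨_, inl_mem_kerSubgroup_iff.2 (hDact u hu), ?_⟩
    rw [hS.mul_inl, hS.rightHom_eq hW hx, reflAct_reflAct]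
  have hmul : ∀ z, (∃ k ∈ kerSubgroup S D, z = x * k) → ∀ y, (y ∈ kerSubgroup S D ∨
      ∃ k ∈ kerSubgroup S D, y = x * k) → (z * y ∈ kerSubgroup S D ∨
      ∃ k ∈ kerSubgroup S D, z * y = x * k) := by
    rintro _ ⟨k, hk, rfl⟩ y (hy | ⟨l, hl, rfl⟩)
    · exact Or.inr ⟨k * y, mul_mem hk hy, mul_assoc _ _ _⟩
    · obtain ⟨k', hk', h⟩ := hswap hk
      left
      have h1 : x * k * (x * l) = x * x * (k' * l) := by
        calc x * k * (x * l) = x * (k * x) * l := by simp only [mul_assoc]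
          _ = _ := by rw [h]; simp only [mul_assoc]
      rw [h1]
      exact mul_mem (hsq hx) (mul_mem hk' hl)
  have hcoset : ∀ z ∈ reflQ S σ, z = x * (x⁻¹ * z) ∧ x⁻¹ * z ∈ kerSubgroup S D := fun z hz =>
    ⟨(mul_inv_cancel_left x z).symm, hmono (hS.inv_mul_mem_kerSubgroup hW hx hz)⟩
  induction hy using Subgroup.closure_induction_left with
  | one => exact Or.inl (one_mem _)
  | mul_left z hz y hy ih => exact hmul z ⟨_, (hcoset z hz).2, (hcoset z hz).1⟩ y ih
  | inv_mul_cancel z hz y hy ih =>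
    -- Inverses also lie in xD, because z⁻¹ = z · z⁻² with z² in D.
    refine hmul z⁻¹ ⟨x⁻¹ * z * (z * z)⁻¹, mul_mem (hcoset z hz).2 (inv_mem (hsq hz)), ?_⟩ y ih
    group

end ReflectionExtension

/-! ### The group generated by the square roots of a reflection -/

section ReflectionExtension

variable {V : Type*} [AddCommGroup V] [Module ℚ_[2] V] [FiniteDimensional ℚ_[2] V]
  {W : Subgroup (V ≃ₗ[ℚ_[2]] V)} [Finite W] {R : Type*} [Group R]
  {S : GroupExtension (Multiplicative (ReflModule W)) R W}

/-- For x in Q_σ and c in C_σ, one has c = x⁻¹(xc) with xc again in Q_σ, and `σ` = x². -/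
theorem IsReflectionExtension.inl_mem_closure_reflQ (hS : IsReflectionExtension S)
    (hW : IsReflectionGroup W) {σ : Reflections W} {c z : ReflModule W} (hc : c ∈ reflC σ)
    (hz : z ∈ AddSubgroup.zmultiples (Finsupp.single σ (1 : ℤ))) :
    S.inl (Multiplicative.ofAdd (c + z)) ∈ Subgroup.closure (reflQ S σ) := by
  obtain ⟨x, hx⟩ := hS.reflQ_nonempty σ
  have hx' := Subgroup.subset_closure hx
  obtain ⟨m, rfl⟩ := hz
  rw [ofAdd_add, map_mul]
  refine mul_mem ?_ ?_
  · have h := mul_mem (inv_mem hx')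
      (Subgroup.subset_closure (hS.mul_mem_reflQ hW hx (inl_mem_kerSubgroup_iff.2 hc)))
    rwa [inv_mul_cancel_left] at h
  · change S.inl (Multiplicative.ofAdd (m • Finsupp.single σ (1 : ℤ))) ∈ _
    rw [ofAdd_zsmul, map_zpow, ← show x ^ 2 = _ from hx]
    exact zpow_mem (pow_mem hx' 2) m

-- On ℤσ the operator 1 + σ is multiplication by 2, hence injective, while it kills C_σ.
omit [FiniteDimensional ℚ_[2] V] in
theorem disjoint_reflC_zmultiples (σ : Reflections W) :
    Disjoint (reflC σ) (AddSubgroup.zmultiples (Finsupp.single σ (1 : ℤ))) := by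
  rw [AddSubgroup.disjoint_def]
  rintro _ hc ⟨m, rfl⟩
  have h1 := (mem_reflC_iff σ _).1 hc
  simp only [map_zsmul, reflAct_single, σ.smul_self] at h1
  have h2 := DFunLike.congr_fun h1 σ
  simp only [Finsupp.add_apply, Finsupp.smul_apply, Finsupp.single_eq_same, smul_eq_mul, mul_one,
    Finsupp.zero_apply] at h2
  have h3 : m = 0 := by omega
  simp [h3]

/-- The extension `1 → C_σ ⊕ ℤσ → ⟨Q_σ⟩ → ⟨σ⟩ → 1`. -/
noncomputable def IsReflectionExtension.rootExtension (hS : IsReflectionExtension S)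
    (hW : IsReflectionGroup W) (σ : Reflections W) :
    GroupExtension
      (Multiplicative (reflC σ × AddSubgroup.zmultiples (Finsupp.single σ (1 : ℤ))))
      (Subgroup.closure (reflQ S σ)) (Subgroup.zpowers σ.1) where
  inl := (S.inl.comp (AddMonoidHom.toMultiplicative
      ((reflC σ).subtype.coprod
        (AddSubgroup.zmultiples (Finsupp.single σ (1 : ℤ))).subtype))).codRestrict
    (Subgroup.closure (reflQ S σ)) fun y =>
      hS.inl_mem_closure_reflQ hW y.toAdd.1.2 y.toAdd.2.2
  rightHom := (S.rightHom.comp (Subgroup.closure (reflQ S σ)).subtype).codRestrict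
    (Subgroup.zpowers σ.1) fun y => by
      have h : Subgroup.closure (reflQ S σ) ≤ (Subgroup.zpowers σ.1).comap S.rightHom :=
        (Subgroup.closure_le _).2 fun x hx => by
          rw [SetLike.mem_coe, Subgroup.mem_comap, hS.rightHom_eq hW hx]
          exact Subgroup.mem_zpowers _
      exact h y.2
  inl_injective := by
    rw [injective_iff_map_eq_one]
    intro y hy
    have h1 : S.inl (Multiplicative.ofAdd (y.toAdd.1.1 + y.toAdd.2.1)) = 1 :=
      congrArg Subtype.val hy
    have h2 : y.toAdd.1.1 + y.toAdd.2.1 = 0 := S.inl_injective (h1.trans (map_one S.inl).symm)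
    have h3 := AddSubgroup.disjoint_iff_add_eq_zero.1 (disjoint_reflC_zmultiples σ)
      y.toAdd.1.2 y.toAdd.2.2 h2
    exact Multiplicative.toAdd.injective (Prod.ext (Subtype.ext h3.1) (Subtype.ext h3.2))
  range_inl_eq_ker_rightHom := by
    ext y
    rw [MonoidHom.mem_range, MonoidHom.mem_ker]
    constructor
    · rintro ⟨z, rfl⟩
      exact Subtype.ext (S.rightHom_inl _)
    · intro hy
      have hy1 : S.rightHom y.1 = 1 := congrArg Subtype.val hy
      obtain ⟨x, hx⟩ := hS.reflQ_nonempty σ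
      rcases hS.mem_closure_reflQ hW hx y.2 with h | ⟨k, hk, h⟩
      · obtain ⟨u, hu, huy⟩ := mem_kerSubgroup_iff.1 h
        obtain ⟨c, hc, z, hz, rfl⟩ := AddSubgroup.mem_sup.1 hu
        exact ⟨Multiplicative.ofAdd (⟨c, hc⟩, ⟨z, hz⟩), Subtype.ext huy⟩
      -- An element of the second coset maps to `σ`, which is nontrivial because it negates a
      -- nonzero vector.
      · obtain ⟨u, -, rfl⟩ := mem_kerSubgroup_iff.1 hk
        rw [h, map_mul, S.rightHom_inl, mul_one, hS.rightHom_eq hW hx] at hy1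
        obtain ⟨a, ha, hσa⟩ := σ.exists_neg
        rw [hy1] at hσa
        exact absurd hσa (ne_neg_self ha)
  rightHom_surjective := by
    rintro ⟨_, m, rfl⟩
    obtain ⟨x, hx⟩ := hS.reflQ_nonempty σ
    refine ⟨⟨x, Subgroup.subset_closure hx⟩ ^ m, Subtype.ext ?_⟩
    change S.rightHom (x ^ m) = σ.1 ^ m
    rw [map_zpow, hS.rightHom_eq hW hx]

end ReflectionExtension

theorem mainTheorem6 {V : Type*} [AddCommGroup V] [Module ℚ_[2] V] [FiniteDimensional ℚ_[2] V]
    (W : Subgroup (V ≃ₗ[ℚ_[2]] V)) [Finite W] (hW : IsReflectionGroup W)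
    {R : Type*} [Group R] (S : GroupExtension (Multiplicative (ReflModule W)) R W)
    (hS : IsReflectionExtension S) :
    -- conjugation by `x` over `w` takes `C_σ`, `Q_σ` to `C_{wσw⁻¹}`, `Q_{wσw⁻¹}`
    (∀ (σ : Reflections W) (x : R),
      (fun y => x * y * x⁻¹) '' (kerSubgroup S (reflC σ) : Set R) =
        kerSubgroup S (reflC (S.rightHom x • σ)) ∧
      (fun y => x * y * x⁻¹) '' reflQ S σ = reflQ S (S.rightHom x • σ)) ∧
    -- there are no involutions
    (∀ x : R, orderOf x ≠ 2) ∧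
    ∀ σ : Reflections W,
      -- `π(Q_σ) = {σ}`
      S.rightHom '' reflQ S σ = {σ.1} ∧
      -- `C_σ = ker(1 + σ)`
      reflC σ = (AddMonoidHom.id (ReflModule W) + reflAct σ.1).ker ∧
      -- `Q_σ` is a coset of `C_σ`
      (reflQ S σ).Nonempty ∧
      (∀ x ∈ reflQ S σ,
        reflQ S σ = (fun c => x * c) '' (kerSubgroup S (reflC σ) : Set R) ∧
        reflQ S σ = (fun c => c * x) '' (kerSubgroup S (reflC σ) : Set R)) ∧
      -- the exact sequence `1 → C_σ ⊕ ℤσ → ⟨Q_σ⟩ → ⟨σ⟩ → 1`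
      ∃ T : GroupExtension
          (Multiplicative (reflC σ × AddSubgroup.zmultiples (Finsupp.single σ (1 : ℤ))))
          (Subgroup.closure (reflQ S σ)) (Subgroup.zpowers σ.1),
        (∀ c z, (T.inl (Multiplicative.ofAdd (c, z)) : R) =
          S.inl (Multiplicative.ofAdd (c.1 + z.1))) ∧
        ∀ x, (T.rightHom x : W) = S.rightHom x := by
  refine ⟨fun σ x => ⟨?_, ?_⟩, hS.orderOf_ne_two hW, fun σ => ⟨?_, reflC_eq_ker σ,
    hS.reflQ_nonempty σ, fun x hx => hS.reflQ_eq_coset hW hx, hS.rootExtension hW σ,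
    fun c z => rfl, fun x => rfl⟩⟩
  · exact image_conj_eq (S := S) (A := fun σ => (kerSubgroup S (reflC σ) : Set R))
      (fun σ x y hy => hS.conj_mem_kerSubgroup x hy) σ x
  · exact image_conj_eq (fun σ x y hy => hS.conj_mem_reflQ x hy) σ x
  · obtain ⟨x, hx⟩ := hS.reflQ_nonempty σ
    refine Set.Subset.antisymm ?_ (Set.singleton_subset_iff.2 ⟨x, hx, hS.rightHom_eq hW hx⟩)
    rintro _ ⟨y, hy, rfl⟩
    exact hS.rightHom_eq hW hy
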